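/- \textbf{Theorem.} A $d$-dimensional \emph{constant-rate multi-mode system} (MMS), $d \geq 1$, is a finite set $\mathcal{M} \subseteq \mathbb{R}^d$ of modes. An infinite schedule is a sequence $\pi = (\alpha_1, m_1)(\alpha_2, m_2)\cdots$ with $\alpha_i \in \mathbb{R}_{>0}$ and $m_i \in \mathcal{M}$; it is \emph{non-Zeno} if $\sum_i \alpha_i = \infty$. From a point $x_0 \in \mathbb{R}^d$, it induces the execution $\sigma$ that visits the points $x_j := x_{j-1} + \alpha_j m_j$ at the times $\alpha_1 + \cdots + \alpha_j$ and moves linearly in between; $\sigma(\tau)$ is its position at time $\tau$. A \emph{zone} is a set $\{x \in \mathbb{R}^d : Ax \leq b\}$, represented by an integer matrix $A$ and an integer vector $b$. LTL formulas are given by $\varphi ::= \mathit{true} \mid Z \mid \neg\varphi \mid \varphi \land \varphi \mid \varphi \lor \varphi \mid \mathsf{F}\varphi \mid \mathsf{G}\varphi \mid \varphi\,\mathsf{U}\,\varphi$, where $Z$ is a zone. They are interpreted at times $\tau \geq 0$ of an execution $\sigma$: $\sigma, \tau \models Z$ iff $\sigma(\tau) \in Z$; the Boolean connectives are as usual; $\sigma,\tau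 \models \mathsf{F}\varphi$ (resp. $\mathsf{G}\varphi$) iff $\sigma,\tau' \models \varphi$ for some (resp. all) $\tau' \geq \tau$; and $\sigma,\tau \models \varphi\,\mathsf{U}\,\psi$ iff there is $\tau' \geq \tau$ with $\sigma,\tau' \models \psi$ and $\sigma,\tau'' \models \varphi$ for all $\tau'' \in [\tau,\tau')$. We write $x \models_{\mathcal{M}} \varphi$ iff some non-Zeno infinite schedule of $\mathcal{M}$ induces, from $x$, an execution $\sigma$ with $\sigma, 0 \models \varphi$. For a set $X$ of operators, $\mathrm{LTL}_{\mathrm{B}}(X)$ is the set of formulas that only use operators from $X$ and whose zones are all bounded. The \emph{model-checking problem} of $\mathrm{LTL}_{\mathrm{B}}(X)$ asks, given $d \geq 1$, a $d$-dimensional MMS $\mathcal{M}$ and a point $x$ with rational entries, and a formula $\varphi \in \mathrm{LTL}_{\mathrm{B}}(X)$ over zones of $\mathbb{R}^d$, whether $x \models_{\mathcal{M}} \varphi$. The model-checking problems of $\mathrm{LTL}_{\mathrm{B}}(\mathsf{U})$ and of $\mathrm{LTL}_{\mathrm{B}}(\mathsf{G}, \lor)$ are both undecidable: for neither is there an algorithm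 that, given (an encoding of) any such $\mathcal{M}$, $x$, $\varphi$, correctly decides whether $x \models_{\mathcal{M}} \varphi$. -/

import Mathlib

namespace MultiMode

/-! ### Constant-rate multi-mode systems, schedules and executions -/

/-- A `d`-dimensional constant-rate multi-mode system (MMS): a finite set of modes in `ℝ^d`. -/
abbrev MMS (d : ℕ) := Finset (Fin d → ℝ)

/-- An infinite schedule `(α₀, m₀) (α₁, m₁) ⋯` of `M`, with durations `αₙ > 0` and modes
`mₙ ∈ M`. -/
structure Schedule {d : ℕ} (M : MMS d) where
  dur : ℕ → ℝ
  mode : ℕ → (Fin d → ℝ)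
  dur_pos : ∀ n, 0 < dur n
  mode_mem : ∀ n, mode n ∈ M

/-- An infinite execution `x₀ I₀ x₁ I₁ ⋯` with `Iⱼ = [time j, time (j + 1)]`. -/
structure Execution (d : ℕ) where
  point : ℕ → (Fin d → ℝ)
  time : ℕ → ℝ
  time_zero : time 0 = 0
  time_strictMono : StrictMono time

namespace Execution

variable {d : ℕ}

/-- The union of the intervals of the execution. -/
def dom (σ : Execution d) : Set ℝ := ⋃ j, Set.Icc (σ.time j) (σ.time (j + 1))

/-- The affine interpolation between `point j` and `point (j + 1)` on the `j`-th interval. -/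
noncomputable def interp (σ : Execution d) (j : ℕ) (τ : ℝ) : Fin d → ℝ :=
  σ.point j +
    ((τ - σ.time j) / (σ.time (j + 1) - σ.time j)) • (σ.point (j + 1) - σ.point j)

open Classical in
/-- The value `σ(τ)`: the interpolation on any interval that contains `τ`
(see `val_eq_interp`), and a dummy value for `τ` outside of the domain. -/
noncomputable def val (σ : Execution d) (τ : ℝ) : Fin d → ℝ :=
  if h : ∃ j, τ ∈ Set.Icc (σ.time j) (σ.time (j + 1)) then σ.interp (Nat.find h) τ else 0

/-- The value of an execution does not depend on the interval used to compute it. -/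
theorem val_eq_interp (σ : Execution d) {j : ℕ} {τ : ℝ}
    (hj : τ ∈ Set.Icc (σ.time j) (σ.time (j + 1))) : σ.val τ = σ.interp j τ := by
  classical
  have h : ∃ j, τ ∈ Set.Icc (σ.time j) (σ.time (j + 1)) := ⟨j, hj⟩
  rw [val, dif_pos h]
  obtain ⟨h1, h2⟩ := Nat.find_spec h
  have hle : Nat.find h ≤ j := Nat.find_min' h hj
  generalize Nat.find h = k at h1 h2 hle
  rcases hle.eq_or_lt with rfl | hlt
  · rfl
  · have h3 : σ.time (k + 1) ≤ σ.time j := σ.time_strictMono.monotone hlt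
    have h4 : τ = σ.time (k + 1) := le_antisymm h2 (h3.trans hj.1)
    have h5 : σ.time (k + 1) = σ.time j := le_antisymm h3 (h4 ▸ hj.1)
    have h6 : k + 1 = j := σ.time_strictMono.injective h5
    subst h6
    have h7 : σ.time (k + 1) - σ.time k ≠ 0 :=
      sub_ne_zero.2 (σ.time_strictMono (Nat.lt_succ_self k)).ne'
    rw [interp, interp, h4, div_self h7]
    simp

end Execution

namespace Schedule

variable {d : ℕ} {M : MMS d}

/-- The execution induced by the schedule `π` from the point `x`. -/
noncomputable def induced (π : Schedule M) (x : Fin d → ℝ) : Execution d where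
  point n := x + ∑ i ∈ Finset.range n, π.dur i • π.mode i
  time n := ∑ i ∈ Finset.range n, π.dur i
  time_zero := by simp
  time_strictMono := strictMono_nat_of_lt_succ fun n => by
    rw [Finset.sum_range_succ]
    exact lt_add_of_pos_right _ (π.dur_pos n)

/-- The total duration of the schedule is infinite. -/
def NonZeno (π : Schedule M) : Prop :=
  Filter.Tendsto (fun n => ∑ i ∈ Finset.range n, π.dur i) Filter.atTop Filter.atTop

end Schedule

/-! ### Zones and linear temporal logic -/

/-- A presentation `A x ≤ b`, with integer coefficients, of a zone of `ℝ^d`. -/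
structure Zone (d : ℕ) where
  k : ℕ
  A : Matrix (Fin k) (Fin d) ℤ
  b : Fin k → ℤ

/-- The closed convex polytope `{x ∈ ℝ^d : A x ≤ b}`. -/
def Zone.toSet {d : ℕ} (Z : Zone d) : Set (Fin d → ℝ) :=
  {x | ∀ i, ∑ j, (Z.A i j : ℝ) * x j ≤ (Z.b i : ℝ)}

/-- LTL formulas whose atomic propositions are zones of `ℝ^d`. -/
inductive LTL (d : ℕ) where
  | tt : LTL d
  | zone (Z : Zone d) : LTL d
  | neg (φ : LTL d) : LTL d
  | and (φ ψ : LTL d) : LTL d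
  | or (φ ψ : LTL d) : LTL d
  | F (φ : LTL d) : LTL d
  | G (φ : LTL d) : LTL d
  | U (φ ψ : LTL d) : LTL d

/-- The operators of LTL. -/
inductive Op where
  | neg | and | or | F | G | U

namespace LTL

variable {d : ℕ}

/-- `Sat σ φ τ` stands for `σ, τ ⊨ φ`. Points in time range over the domain of `σ`, which is
the set of all non-negative reals if `σ` is induced by a non-Zeno schedule. -/
def Sat (σ : Execution d) : LTL d → ℝ → Prop
  | tt, _ => True
  | zone Z, τ => σ.val τ ∈ Z.toSet
  | neg φ, τ => ¬ Sat σ φ τ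
  | and φ ψ, τ => Sat σ φ τ ∧ Sat σ ψ τ
  | or φ ψ, τ => Sat σ φ τ ∨ Sat σ ψ τ
  | F φ, τ => ∃ τ' ∈ σ.dom, τ ≤ τ' ∧ Sat σ φ τ'
  | G φ, τ => ∀ τ' ∈ σ.dom, τ ≤ τ' → Sat σ φ τ'
  | U φ ψ, τ => ∃ τ' ∈ σ.dom, τ ≤ τ' ∧ Sat σ ψ τ' ∧ ∀ τ'' ∈ Set.Ico τ τ', Sat σ φ τ''

/-- The set of operators that occur in a formula. -/
def operators : LTL d → Set Op
  | tt => ∅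
  | zone _ => ∅
  | neg φ => {Op.neg} ∪ operators φ
  | and φ ψ => {Op.and} ∪ operators φ ∪ operators ψ
  | or φ ψ => {Op.or} ∪ operators φ ∪ operators ψ
  | F φ => {Op.F} ∪ operators φ
  | G φ => {Op.G} ∪ operators φ
  | U φ ψ => {Op.U} ∪ operators φ ∪ operators ψ

/-- The set of zones that occur in a formula. -/
def zones : LTL d → Set (Zone d)
  | tt => ∅
  | zone Z => {Z}
  | neg φ => zones φ
  | and φ ψ => zones φ ∪ zones ψ
  | or φ ψ => zones φ ∪ zones ψ
  | F φ => zones φ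
  | G φ => zones φ
  | U φ ψ => zones φ ∪ zones ψ

/-- The fragment `LTL_B(X)`: only operators from `X`, and only bounded zones. -/
def fragmentB (d : ℕ) (X : Set Op) : Set (LTL d) :=
  {φ | φ.operators ⊆ X ∧ ∀ Z ∈ φ.zones, Bornology.IsBounded Z.toSet}

end LTL

/-- `x ⊨_M φ`: some non-Zeno infinite schedule of `M` induces, from `x`, an execution that
satisfies `φ`. -/
def Models {d : ℕ} (M : MMS d) (x : Fin d → ℝ) (φ : LTL d) : Prop :=
  ∃ π : Schedule M, π.NonZeno ∧ LTL.Sat (π.induced x) φ 0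

/-! ### The model-checking problem and its encoding as finite words -/

/-- The point of `ℝ^d` given by a rational vector. -/
def toReal {d : ℕ} (v : Fin d → ℚ) : Fin d → ℝ := fun i => (v i : ℝ)

/-- An input of the model-checking problem, with rational data. The modes are given as a list,
in any order. -/
structure MCInput where
  d : ℕ
  one_le_d : 1 ≤ d
  modes : List (Fin d → ℚ)
  start : Fin d → ℚ
  formula : LTL d

namespace MCInput

open Classical in
/-- The MMS of an input. -/
noncomputable def mms (I : MCInput) : MMS I.d := (I.modes.map toReal).toFinset

/-- The question asked by the model-checking problem. -/
def Answer (I : MCInput) : Prop := Models I.mms (toReal I.start) I.formula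

end MCInput

/-- A rational vector is written as the list of the numerators and denominators of its
coordinates. -/
def vecCode {d : ℕ} (v : Fin d → ℚ) : List (ℤ × ℕ) :=
  List.ofFn fun i => ((v i).num, (v i).den)

/-- A zone is written as the list of its inequalities, each being the list of its coefficients
followed by its bound. -/
def Zone.code {d : ℕ} (Z : Zone d) : List (List ℤ × ℤ) :=
  List.ofFn fun i => (List.ofFn (Z.A i), Z.b i)

/-- A formula is written as a word in prefix (Polish) notation; its letters are the
numbers `0, …, 6`, for `true` and the six operators, and the codes of zones. -/
def LTL.code {d : ℕ} : LTL d → List (ℕ ⊕ List (List ℤ × ℤ))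
  | .tt => [.inl 0]
  | .zone Z => [.inr Z.code]
  | .neg φ => .inl 1 :: φ.code
  | .and φ ψ => .inl 2 :: (φ.code ++ ψ.code)
  | .or φ ψ => .inl 3 :: (φ.code ++ ψ.code)
  | .F φ => .inl 4 :: φ.code
  | .G φ => .inl 5 :: φ.code
  | .U φ ψ => .inl 6 :: (φ.code ++ ψ.code)

/-- The type of the codes of inputs: modes, starting point, formula. -/
abbrev Code := List (List (ℤ × ℕ)) × List (ℤ × ℕ) × List (ℕ ⊕ List (List ℤ × ℤ))

/-- The code of an input of the model-checking problem. -/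
def MCInput.code (I : MCInput) : Code :=
  (I.modes.map vecCode, vecCode I.start, I.formula.code)

theorem vecCode_injective {d : ℕ} : Function.Injective (vecCode (d := d)) := by
  intro v w h
  have h' := List.ofFn_injective h
  funext i
  have hi := congrFun h' i
  simp only [Prod.mk.injEq] at hi
  exact Rat.ext hi.1 hi.2

theorem Zone.code_injective {d : ℕ} : Function.Injective (Zone.code (d := d)) := by
  rintro ⟨k, A, b⟩ ⟨k', A', b'⟩ h
  have hk : k = k' := by simpa [Zone.code] using congrArg List.length h
  subst hk
  have h' := List.ofFn_injective h
  have hA : A = A' := by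
    funext i
    exact List.ofFn_injective (congrArg Prod.fst (congrFun h' i))
  have hb : b = b' := by
    funext i
    exact congrArg Prod.snd (congrFun h' i)
  rw [hA, hb]

/-- Prefix notation is uniquely readable. -/
theorem LTL.code_append_inj {d : ℕ} (φ : LTL d) :
    ∀ (ψ : LTL d) (s t : List (ℕ ⊕ List (List ℤ × ℤ))),
      φ.code ++ s = ψ.code ++ t → φ = ψ ∧ s = t := by
  induction φ with
  | tt => intro ψ s t h; cases ψ <;> simp_all [LTL.code]
  | zone Z =>
    intro ψ s t h
    cases ψ <;> simp_all [LTL.code]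
    exact Zone.code_injective h.1
  | neg φ ih =>
    intro ψ s t h
    cases ψ <;> simp [LTL.code] at h
    obtain ⟨rfl, rfl⟩ := ih _ _ _ h; simp
  | F φ ih =>
    intro ψ s t h
    cases ψ <;> simp [LTL.code] at h
    obtain ⟨rfl, rfl⟩ := ih _ _ _ h; simp
  | G φ ih =>
    intro ψ s t h
    cases ψ <;> simp [LTL.code] at h
    obtain ⟨rfl, rfl⟩ := ih _ _ _ h; simp
  | and φ₁ φ₂ ih₁ ih₂ =>
    intro ψ s t h
    cases ψ <;> simp [LTL.code] at h
    obtain ⟨rfl, h⟩ := ih₁ _ _ _ h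
    obtain ⟨rfl, rfl⟩ := ih₂ _ _ _ (List.append_cancel_left h); simp
  | or φ₁ φ₂ ih₁ ih₂ =>
    intro ψ s t h
    cases ψ <;> simp [LTL.code] at h
    obtain ⟨rfl, h⟩ := ih₁ _ _ _ h
    obtain ⟨rfl, rfl⟩ := ih₂ _ _ _ (List.append_cancel_left h); simp
  | U φ₁ φ₂ ih₁ ih₂ =>
    intro ψ s t h
    cases ψ <;> simp [LTL.code] at h
    obtain ⟨rfl, h⟩ := ih₁ _ _ _ h
    obtain ⟨rfl, rfl⟩ := ih₂ _ _ _ (List.append_cancel_left h); simp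

/-- Distinct inputs have distinct codes. -/
theorem MCInput.code_injective : Function.Injective MCInput.code := by
  rintro ⟨d, hd, M, x, φ⟩ ⟨d', hd', M', x', φ'⟩ h
  simp only [MCInput.code, Prod.mk.injEq] at h
  obtain ⟨h1, h2, h3⟩ := h
  have hdd : d = d' := by simpa [vecCode] using congrArg List.length h2
  subst hdd
  obtain rfl := List.map_injective_iff.2 vecCode_injective h1
  obtain rfl := vecCode_injective h2
  obtain rfl := (LTL.code_append_inj φ φ' [] [] (by simpa using h3)).1
  rfl

/-- The model-checking problem of `LTL_B(X)` is decidable: some computable predicate on codes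
gives the right answer on (the code of) every MMS, point and formula from `LTL_B(X)`. Nothing is
asked of the predicate on other codes. -/
def ModelCheckingDecidable (X : Set Op) : Prop :=
  ∃ p : Code → Prop, ComputablePred p ∧
    ∀ I : MCInput, I.formula ∈ LTL.fragmentB I.d X → (p I.code ↔ I.Answer)

end MultiMode

/-! Both problems encode the halting problem of one fixed Turing machine, undecidable even on the
inputs `a sⁿ`. Modes and formula are fixed; only the starting point depends on `n`.

Machine to affine maps. A configuration becomes a point of ℝ³: a number for the state and the
scanned symbol, and one number in (0, 1] for each half-tape, written in base `tapeBase Γ`. A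
transition is a diagonal affine map, guarded by weak linear inequalities on the state, the scanned
symbol and, for a move, the symbol that comes under the head (`TM.enabled_iff`, `TM.apply_encR`).

Affine maps to modes. Additional coordinates hold a control that moves at unit speed along a graph
whose vertices are unit vectors. Each edge has its own bounded zone. Staying in the union of these
zones forces an execution to follow the edges, spending one unit of time on each
(`ControlGraph.onPath_val`). An edge has `m + 1` modes, among which the schedule divides that unit
of time. On the edge that applies `x ↦ F x + b`, only mode `i` changes `xᵢ`, which it drains at rate
`K`, and the zone requires `0 ≤ xᵢ ≤ K c`, where `c` is the control at the source. As `c` ends at 0,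
mode `i` must be used for time exactly `xᵢ / K`. Suitable rates on a second copy of the data then
add up to `F x + b`, and a further edge copies the result back in the same way. Thus executions
yield runs (`AffineSystem.closed_stage`), and runs yield executions
(`AffineSystem.exists_schedule`).

Formulas. With `G`, a disjunction of the edge zones holds forever iff the machine does not halt;
since every edge takes unit time, non-Zeno schedules give arbitrarily long runs. With `U`, the final
zone tests for a halting state, and the disjunction on the left is replaced by `Z₁ U (Z₂ U ⋯)`.
Where this holds, some zone holds; and it holds throughout a simulation, because the zones are
listed in the order guards, maps, copy in which each round visits them. -/

open Turing

/-! ### Turing machines with an undecidable halting problem -/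

/-- The word `1ⁿ` in binary, least significant bit first, stands for `2 ^ n - 1`. -/
theorem Turing.PartrecToTM2.trNat_two_pow_sub_one (n : ℕ) :
    PartrecToTM2.trNat (2 ^ n - 1) = List.replicate n PartrecToTM2.Γ'.bit1 := by
  have key : ∀ m : ℕ, PartrecToTM2.trNat (2 * m + 1) =
      PartrecToTM2.Γ'.bit1 :: PartrecToTM2.trNat m := by
    intro m
    have h : ((2 * m + 1 : ℕ) : Num) = Num.bit1 (m : Num) := by
      have := Num.bit1_of_bit1 (m : Num)
      rw [← this]; push_cast; ring
    rw [PartrecToTM2.trNat, PartrecToTM2.trNat, h]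
    cases (m : Num) <;> rfl
  induction n with
  | zero => simp
  | succ n ih =>
    have h1 : 1 ≤ 2 ^ n := Nat.one_le_two_pow
    have : 2 ^ (n + 1) - 1 = 2 * (2 ^ n - 1) + 1 := by rw [pow_succ]; omega
    rw [this, key, ih, List.replicate_succ]

/-- A partial recursive function whose domain, along the numbers `2 ^ n - 1`, is undecidable. -/
theorem exists_partrec_undecidable_two_pow :
    ∃ f : ℕ →. ℕ, Partrec f ∧ ¬ ComputablePred fun n : ℕ => (f (2 ^ n - 1)).Dom := by
  -- The partial inverse of `n ↦ 2 ^ n - 1`: running the `n`-th code after it turns the domain along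
  -- these numbers into the halting set.
  let g : ℕ →. ℕ := fun m => Nat.rfind fun n => (Part.some (decide (2 ^ n = m + 1)) : Part Bool)
  have hg : Partrec g := by
    refine Partrec.rfind ?_
    have hpow : Primrec fun n : ℕ => 2 ^ n :=
      (Primrec.nat_rec₁ (f := fun _ x => 2 * x) 1
        (Primrec.nat_mul.comp (Primrec.const 2) Primrec.snd).to₂).of_eq fun n => by
          induction n with
          | zero => rfl
          | succ n ih => simp only [ih]; ring
    have : PrimrecPred fun p : ℕ × ℕ => 2 ^ p.2 = p.1 + 1 :=
      Primrec.eq.comp (hpow.comp Primrec.snd) (Primrec.succ.comp Primrec.fst)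
    exact (Computable.of_eq this.decide.to_comp fun _ => rfl).partrec
  have hgv : ∀ n, g (2 ^ n - 1) = Part.some n := by
    intro n
    have h1 : 2 ^ n - 1 + 1 = 2 ^ n := Nat.sub_add_cancel Nat.one_le_two_pow
    refine Part.eq_some_iff.2 (Nat.mem_rfind.2 ⟨?_, fun {m} hm => ?_⟩)
    · simp [h1]
    · have : 2 ^ m ≠ 2 ^ n := fun h => hm.ne (Nat.pow_right_injective le_rfl h)
      simp [h1, this]
  refine ⟨fun m => (g m).bind fun n => (Denumerable.ofNat Nat.Partrec.Code n).eval 0, ?_, ?_⟩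
  · refine hg.bind ?_
    exact Nat.Partrec.Code.eval_part.comp
      ((Computable.ofNat Nat.Partrec.Code).comp Computable.snd) (Computable.const 0)
  · intro h
    refine ComputablePred.halting_problem 0 ?_
    obtain ⟨q, hq, hq'⟩ := ComputablePred.computable_iff.1 h
    refine ComputablePred.computable_iff.2
      ⟨fun c => q (Encodable.encode c), hq.comp Computable.encode, funext fun c => ?_⟩
    have := congrFun hq' (Encodable.encode c)
    simpa [hgv] using this

instance : Finite PartrecToTM2.K' :=
  Finite.of_injective
    (fun k => match k with
      | .main => (0 : Fin 4) | .rev => 1 | .aux => 2 | .stack => 3)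
    (by rintro (_ | _ | _ | _) (_ | _ | _ | _) h <;> first | rfl | simp at h)

/-- A Turing machine with finitely many states and symbols, and an undecidable halting problem
even for inputs of the form `a sⁿ`. -/
theorem exists_TM0_undecidable :
    ∃ (Γ Λ : Type) (_ : Inhabited Γ) (_ : Finite Γ) (_ : Inhabited Λ) (M : TM0.Machine Γ Λ)
      (S : Finset Λ) (a s : Γ), s ≠ default ∧ TM0.Supports M ↑S ∧
      ¬ ComputablePred fun n : ℕ =>
        (StateTransition.eval (TM0.step M) (TM0.init (a :: List.replicate n s))).Dom := by
  classical
  obtain ⟨f, hf, hund⟩ := exists_partrec_undecidable_two_pow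
  obtain ⟨c, hc⟩ := ToPartrec.Code.exists_code (Nat.Partrec'.part_iff₁.2 hf)
  let _ : Inhabited PartrecToTM2.Λ' := ⟨PartrecToTM2.trNormal c PartrecToTM2.Cont'.halt⟩
  have _ : Fintype PartrecToTM2.K' := Fintype.ofFinite _
  let tr : PartrecToTM2.Λ' → TM2.Stmt (fun _ : PartrecToTM2.K' => PartrecToTM2.Γ')
    PartrecToTM2.Λ' (Option PartrecToTM2.Γ') := PartrecToTM2.tr
  -- The type of labels need not be finite; the finite support provides the set of states `S`.
  let sup := TM1to0.tr_supports _ (TM2to1.tr_supports tr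
    (PartrecToTM2.tr_supports c PartrecToTM2.Cont'.halt))
  let sym : PartrecToTM2.Γ' → ∀ k : PartrecToTM2.K', Option PartrecToTM2.Γ' :=
    fun x => Function.update (fun _ => none) PartrecToTM2.K'.main (some x)
  refine ⟨TM2to1.Γ' PartrecToTM2.K' fun _ => PartrecToTM2.Γ', _, inferInstance, inferInstance,
    inferInstance, _, _, (true, sym .cons), (false, sym .bit1), ?_, sup, ?_⟩
  · intro h
    have h2 := congrFun (congrArg Prod.snd h) PartrecToTM2.K'.main
    simp [sym] at h2
  · refine fun h => hund (h.of_eq fun n => ?_)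
    have h1 : (f (2 ^ n - 1)).Dom ↔ (c.eval [2 ^ n - 1]).Dom := by
      have := hc ⟨[2 ^ n - 1], rfl⟩
      simp only at this
      rw [this]
      simp [List.Vector.head]
    have h2 : (c.eval [2 ^ n - 1]).Dom ↔ (TM2.eval tr PartrecToTM2.K'.main
        (PartrecToTM2.trList [2 ^ n - 1])).Dom := by
      have h3 := PartrecToTM2.tr_eval c [2 ^ n - 1]
      have h4 : PartrecToTM2.init c [2 ^ n - 1] =
          TM2.init PartrecToTM2.K'.main (PartrecToTM2.trList [2 ^ n - 1]) := by
        unfold PartrecToTM2.init TM2.init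
        congr 1
        funext k
        cases k <;> simp [Function.update]
      rw [h4] at h3
      change _ ↔ (StateTransition.eval (TM2.step PartrecToTM2.tr) _).Dom
      rw [h3]
      simp
    -- The stack is written in reverse, so the separator `cons` comes first and carries the mark of
    -- the stack bottom; the `n` bits of `2 ^ n - 1` follow.
    have h5 : TM2to1.trInit PartrecToTM2.K'.main (PartrecToTM2.trList [2 ^ n - 1]) =
        ((true, sym .cons) :: List.replicate n (false, sym .bit1) :
          List (TM2to1.Γ' PartrecToTM2.K' fun _ => PartrecToTM2.Γ')) := by
      simp only [TM2to1.trInit, PartrecToTM2.trList, PartrecToTM2.trNat_two_pow_sub_one, sym,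
        List.reverse_append, List.reverse_cons, List.reverse_nil, List.nil_append,
        List.reverse_replicate, List.cons_append]
      exact congrArg (List.cons _) List.map_replicate
    have h6 := TM2to1.tr_eval_dom tr PartrecToTM2.K'.main (PartrecToTM2.trList [2 ^ n - 1])
    rw [← TM1to0.tr_eval, h5] at h6
    rw [h1, h2, ← h6]
    rfl

/-! ### Executions induced by schedules -/

namespace MultiMode
open Filter Topology

namespace Schedule

variable {d : ℕ} {M : MMS d}

theorem induced_time_succ (π : Schedule M) (x : Fin d → ℝ) (n : ℕ) :
    (π.induced x).time (n + 1) = (π.induced x).time n + π.dur n :=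
  Finset.sum_range_succ _ _

theorem induced_point_succ (π : Schedule M) (x : Fin d → ℝ) (n : ℕ) :
    (π.induced x).point (n + 1) = (π.induced x).point n + π.dur n • π.mode n := by
  simp only [induced, Finset.sum_range_succ, add_assoc]

theorem induced_val (π : Schedule M) (x : Fin d → ℝ) {n : ℕ} {τ : ℝ}
    (h : τ ∈ Set.Icc ((π.induced x).time n) ((π.induced x).time (n + 1))) :
    (π.induced x).val τ =
      (π.induced x).point n + (τ - (π.induced x).time n) • π.mode n := by
  rw [Execution.val_eq_interp _ h, Execution.interp, induced_point_succ, induced_time_succ,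
    add_sub_cancel_left, add_sub_cancel_left, smul_smul, div_mul_cancel₀ _ (π.dur_pos n).ne']

theorem induced_val_time (π : Schedule M) (x : Fin d → ℝ) (n : ℕ) :
    (π.induced x).val ((π.induced x).time n) = (π.induced x).point n := by
  rw [induced_val (n := n)]
  · simp
  · exact ⟨le_rfl, (π.induced x).time_strictMono.monotone n.le_succ⟩

theorem nonneg_of_mem_dom {σ : Execution d} {τ : ℝ} (h : τ ∈ σ.dom) : 0 ≤ τ := by
  obtain ⟨j, hj⟩ := Set.mem_iUnion.1 h
  rw [← σ.time_zero]
  exact (σ.time_strictMono.monotone (Nat.zero_le j)).trans hj.1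

end Schedule

/-! ### Control graphs, and executions confined to their regions -/

/-- A graph whose vertices are embedded as the unit vectors of `ℝ^V`, with labels on the edges:
along an edge, the vector of data in `ℝ^δ` changes at one of the `r` given rates while the control
moves at unit speed, and the pair of both has to stay in a prescribed closed convex set. -/
structure ControlGraph (d : ℕ) (V E δ : Type) [DecidableEq V] where
  coord : V ⊕ δ ≃ Fin d
  src : E → V
  tgt : E → V
  src_ne_tgt : ∀ e, src e ≠ tgt e
  edge_inj : ∀ {e e'}, src e = src e' → tgt e = tgt e' → e = e'
  not_antiparallel : ∀ {e e'}, src e = tgt e' → tgt e ≠ src e'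
  r : ℕ
  rate : E → ℕ → δ → ℝ
  region : E → Set (Fin d → ℝ)
  isClosed_region : ∀ e, IsClosed (region e)
  convex_region : ∀ e, Convex ℝ (region e)
  control_nonneg : ∀ {e z}, z ∈ region e → ∀ v, 0 ≤ z (coord (.inl v))
  control_nonpos : ∀ {e z}, z ∈ region e → ∀ v, v ≠ src e → v ≠ tgt e → z (coord (.inl v)) ≤ 0

namespace ControlGraph

variable {d : ℕ} {V E δ : Type} [DecidableEq V] (G : ControlGraph d V E δ)

/-- The point of `ℝ^d` with the given control and data. -/
def pt (c : V → ℝ) (D : δ → ℝ) : Fin d → ℝ := fun i => Sum.elim c D (G.coord.symm i)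

@[simp] theorem pt_inl (c : V → ℝ) (D : δ → ℝ) (v : V) : G.pt c D (G.coord (.inl v)) = c v := by
  simp [pt]

@[simp] theorem pt_inr (c : V → ℝ) (D : δ → ℝ) (i : δ) : G.pt c D (G.coord (.inr i)) = D i := by
  simp [pt]

theorem pt_add_smul (c c' : V → ℝ) (D D' : δ → ℝ) (a : ℝ) :
    G.pt c D + a • G.pt c' D' = G.pt (c + a • c') (D + a • D') := by
  funext i
  simp only [pt, Pi.add_apply, Pi.smul_apply]
  cases G.coord.symm i <;> simp

/-- The control at a vertex. -/
def atVertex (v : V) : V → ℝ := Pi.single v 1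

/-- The control at a fraction `s` of an edge. -/
def onEdge (e : E) (s : ℝ) : V → ℝ := (1 - s) • Pi.single (G.src e) 1 + s • Pi.single (G.tgt e) 1

/-- The `j`-th mode of an edge. -/
def mode (e : E) (j : ℕ) : Fin d → ℝ :=
  G.pt (Pi.single (G.tgt e) 1 - Pi.single (G.src e) 1) (G.rate e j)

theorem onEdge_zero (e : E) : G.onEdge e 0 = atVertex (G.src e) := by simp [onEdge, atVertex]

theorem onEdge_one (e : E) : G.onEdge e 1 = atVertex (G.tgt e) := by simp [onEdge, atVertex]

theorem onEdge_add (e : E) (s a : ℝ) :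
    G.onEdge e s + a • (Pi.single (G.tgt e) 1 - Pi.single (G.src e) 1) = G.onEdge e (s + a) := by
  simp only [onEdge]; module

theorem onEdge_src (e : E) (s : ℝ) : G.onEdge e s (G.src e) = 1 - s := by
  simp [onEdge, Pi.single_eq_of_ne (G.src_ne_tgt e)]

theorem onEdge_tgt (e : E) (s : ℝ) : G.onEdge e s (G.tgt e) = s := by
  simp [onEdge, Pi.single_eq_of_ne (G.src_ne_tgt e).symm]

theorem onEdge_of_ne (e : E) (s : ℝ) {v : V} (h : v ≠ G.src e) (h' : v ≠ G.tgt e) :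
    G.onEdge e s v = 0 := by
  simp [onEdge, Pi.single_eq_of_ne h, Pi.single_eq_of_ne h']

/-- In the region of `e'` the control can be positive only at the ends of `e'`. With neither
parallel nor antiparallel edges, two such vertices determine the edge. -/
theorem edge_eq_of_pos {e e' : E} {c : V → ℝ} {D : δ → ℝ} (h : G.pt c D ∈ G.region e')
    (h1 : 0 < c (G.src e)) (h2 : 0 < c (G.tgt e)) : e' = e := by
  have key : ∀ v, 0 < c v → v = G.src e' ∨ v = G.tgt e' := by
    intro v hv
    by_contra! hn
    have := G.control_nonpos h v hn.1 hn.2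
    rw [pt_inl] at this
    exact absurd hv this.not_gt
  rcases key _ h1 with h1 | h1 <;> rcases key _ h2 with h2 | h2
  · exact absurd (h1.trans h2.symm) (G.src_ne_tgt e)
  · exact G.edge_inj h1.symm h2.symm
  · exact absurd h2 (G.not_antiparallel h1)
  · exact absurd (h1.trans h2.symm) (G.src_ne_tgt e)

/-- A mode that can be used in the interior of an edge is a mode of that edge. -/
theorem edge_eq_of_interior {e e' : E} {s α : ℝ} {D : δ → ℝ} {j : ℕ} (h0 : 0 < s) (h1 : s < 1)
    (hα : 0 < α)
    (hstay : ∀ ε ∈ Set.Ioo 0 α, ∃ e'', G.pt (G.onEdge e s) D + ε • G.mode e' j ∈ G.region e'') :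
    e' = e := by
  -- With `ε` below `s` and `1 - s`, the control stays positive at both ends of `e`, so only the
  -- region of `e` is possible; there the mode can neither lower nor raise the control at another
  -- vertex.
  obtain ⟨ε, hε0, hε⟩ : ∃ ε, 0 < ε ∧ ε < min α (min s (1 - s)) :=
    exists_between (lt_min hα (lt_min h0 (sub_pos.2 h1)))
  obtain ⟨hεα, hεs, hεs'⟩ : ε < α ∧ ε < s ∧ ε < 1 - s := by simpa using hε
  obtain ⟨e'', he''⟩ := hstay ε ⟨hε0, hεα⟩
  rw [mode, pt_add_smul] at he''
  set c := G.onEdge e s + ε • (Pi.single (G.tgt e') 1 - Pi.single (G.src e') 1) with hc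
  have hcv : ∀ v, c v = G.onEdge e s v +
      ε * ((if v = G.tgt e' then 1 else 0) - (if v = G.src e' then 1 else 0)) := by
    intro v; simp [hc, Pi.single_apply]
  have hge : ∀ v, G.onEdge e s v - ε ≤ c v := by
    intro v
    rw [hcv]; split_ifs <;> linarith
  have hee : e'' = e := by
    refine G.edge_eq_of_pos he'' ?_ ?_
    · have := hge (G.src e); rw [onEdge_src] at this; linarith
    · have := hge (G.tgt e); rw [onEdge_tgt] at this; linarith
  subst hee
  have hsrc : G.src e' = G.src e'' ∨ G.src e' = G.tgt e'' := by
    by_contra! hn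
    have := G.control_nonneg he'' (G.src e')
    rw [pt_inl, hcv, onEdge_of_ne _ _ _ hn.1 hn.2, if_neg (G.src_ne_tgt e'), if_pos rfl] at this
    linarith
  have htgt : G.tgt e' = G.src e'' ∨ G.tgt e' = G.tgt e'' := by
    by_contra! hn
    have := G.control_nonpos he'' (G.tgt e') hn.1 hn.2
    rw [pt_inl, hcv, onEdge_of_ne _ _ _ hn.1 hn.2, if_neg (G.src_ne_tgt e').symm,
      if_pos rfl] at this
    linarith
  rcases hsrc with h1 | h1 <;> rcases htgt with h2 | h2
  · exact absurd (h1.trans h2.symm) (G.src_ne_tgt e')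
  · exact G.edge_inj h1 h2
  · exact absurd h2 (G.not_antiparallel h1)
  · exact absurd (h1.trans h2.symm) (G.src_ne_tgt e')

/-- A mode that can be used at a vertex is a mode of an edge that leaves it, in the region of
which we must be. -/
theorem of_vertex {v : V} {e : E} {α : ℝ} {D : δ → ℝ} {j : ℕ} (hα : 0 < α)
    (hstay : ∀ ε ∈ Set.Ioo 0 α, ∃ e', G.pt (atVertex v) D + ε • G.mode e j ∈ G.region e') :
    G.src e = v ∧ G.pt (atVertex v) D ∈ G.region e := by
  have hc : ∀ ε w, (atVertex v + ε • (Pi.single (G.tgt e) 1 - Pi.single (G.src e) 1) : V → ℝ) w =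
      (if w = v then 1 else 0) +
      ε * ((if w = G.tgt e then 1 else 0) - (if w = G.src e then 1 else 0)) := by
    intro ε w; simp [atVertex, Pi.single_apply]
  have hv : G.src e = v := by
    by_contra hn
    obtain ⟨ε, hε0, hε⟩ := exists_between hα
    obtain ⟨e', he'⟩ := hstay ε ⟨hε0, hε⟩
    rw [mode, pt_add_smul] at he'
    have := G.control_nonneg he' (G.src e)
    rw [pt_inl, hc, if_neg hn, if_neg (G.src_ne_tgt e), if_pos rfl] at this
    linarith
  refine ⟨hv, ?_⟩
  subst hv
  have hlim : Tendsto (fun ε : ℝ => G.pt (atVertex (G.src e)) D + ε • G.mode e j) (𝓝[>] 0)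
      (𝓝 (G.pt (atVertex (G.src e)) D)) := by
    have : Continuous fun ε : ℝ => G.pt (atVertex (G.src e)) D + ε • G.mode e j := by fun_prop
    have h2 := this.tendsto 0
    simp only [zero_smul, add_zero] at h2
    exact h2.mono_left nhdsWithin_le_nhds
  -- The region is identified only just after the vertex is left; closedness carries it back to the
  -- vertex.
  refine (G.isClosed_region e).mem_of_tendsto hlim ?_
  filter_upwards [Ioo_mem_nhdsGT (lt_min hα one_pos)] with ε hε
  obtain ⟨hεα, hε1⟩ : ε < α ∧ ε < 1 := by simpa using hε.2
  obtain ⟨e', he'⟩ := hstay ε ⟨hε.1, hεα⟩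
  have h3 := he'
  rw [mode, pt_add_smul] at h3
  have : e' = e := by
    refine G.edge_eq_of_pos h3 ?_ ?_
    · rw [hc, if_pos rfl, if_neg (G.src_ne_tgt e)]; linarith
    · rw [hc, if_neg (G.src_ne_tgt e).symm, if_pos rfl]
      linarith [hε.1]
  exact this ▸ he'

/-- `Q k v D` means that vertex `v` may be reached with data `D` after `k` edges. -/
structure Closed (Q : ℕ → V → (δ → ℝ) → Prop) : Prop where
  step : ∀ {k e D} (lam : ℕ → ℝ), Q k (G.src e) D → (∀ j, 0 ≤ lam j) →
    ∑ j ∈ Finset.range G.r, lam j = 1 → G.pt (atVertex (G.src e)) D ∈ G.region e →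
    G.pt (atVertex (G.tgt e)) (D + ∑ j ∈ Finset.range G.r, lam j • G.rate e j) ∈ G.region e →
    Q (k + 1) (G.tgt e) (D + ∑ j ∈ Finset.range G.r, lam j • G.rate e j)

/-- At time `t`, the point `p` lies on a path along edges from a vertex satisfying `Q`. -/
inductive OnPath (Q : ℕ → V → (δ → ℝ) → Prop) : ℝ → (Fin d → ℝ) → Prop
  | vertex {k v D} (h : Q k v D) : OnPath Q k (G.pt (atVertex v) D)
  | edge {k e D} {lam : ℕ → ℝ} {s : ℝ} (h : Q k (G.src e) D)
      (hr : G.pt (atVertex (G.src e)) D ∈ G.region e) (hlam : ∀ j, 0 ≤ lam j)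
      (hs : ∑ j ∈ Finset.range G.r, lam j = s) (h0 : 0 < s) (h1 : s < 1) :
      OnPath Q (k + s) (G.pt (G.onEdge e s) (D + ∑ j ∈ Finset.range G.r, lam j • G.rate e j))

variable {G}

/-- Only the total time `lam` spent in each mode matters, not the order of use. The control at the
source, `1 - s`, cannot become negative, so the move ends inside the edge or exactly at its target;
in the latter case closedness gives the region at the end point, and `Closed.step` applies. -/
theorem OnPath.along {Q : ℕ → V → (δ → ℝ) → Prop} (hQ : G.Closed Q) {k : ℕ} {e : E} {D : δ → ℝ}
    {lam : ℕ → ℝ} {s α : ℝ} (h : Q k (G.src e) D)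
    (hr : G.pt (atVertex (G.src e)) D ∈ G.region e) (hlam : ∀ j, 0 ≤ lam j)
    (hs : ∑ j ∈ Finset.range G.r, lam j = s) (h0 : 0 ≤ s) (h1 : s < 1) {j : ℕ} (hj : j < G.r)
    (hα : 0 < α)
    (hstay : ∀ ε ∈ Set.Ioo 0 α, ∃ e', G.pt (G.onEdge e s)
      (D + ∑ j ∈ Finset.range G.r, lam j • G.rate e j) + ε • G.mode e j ∈ G.region e') :
    G.OnPath Q (k + s + α) (G.pt (G.onEdge e s)
      (D + ∑ j ∈ Finset.range G.r, lam j • G.rate e j) + α • G.mode e j) := by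
  set lam' : ℝ → ℕ → ℝ := fun ε i => lam i + if i = j then ε else 0 with hlam'
  have hsum : ∀ ε, ∑ i ∈ Finset.range G.r, lam' ε i = s + ε := by
    intro ε
    simp [hlam', Finset.sum_add_distrib, hs, hj]
  have hdata : ∀ ε, G.pt (G.onEdge e s) (D + ∑ j ∈ Finset.range G.r, lam j • G.rate e j) +
      ε • G.mode e j =
      G.pt (G.onEdge e (s + ε)) (D + ∑ i ∈ Finset.range G.r, lam' ε i • G.rate e i) := by
    intro ε
    rw [mode, pt_add_smul, onEdge_add]
    congr 1
    simp [hlam', add_smul, Finset.sum_add_distrib, ite_smul, hj, add_assoc]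
  have hle : s + α ≤ 1 := by
    by_contra! hn
    obtain ⟨ε, hε1, hε2⟩ := exists_between (show 1 - s < α by linarith)
    obtain ⟨e', he'⟩ := hstay ε ⟨by linarith, hε2⟩
    rw [hdata] at he'
    have := G.control_nonneg he' (G.src e)
    rw [pt_inl, onEdge_src] at this
    linarith
  have hnn : ∀ i, 0 ≤ lam' α i := by
    intro i
    simp only [hlam']
    have := hlam i
    split_ifs <;> linarith
  rcases hle.lt_or_eq with hlt | heq
  · rw [hdata, add_assoc]
    exact .edge h hr hnn (hsum α) (by linarith) hlt
  · have hmem : G.pt (G.onEdge e s) (D + ∑ j ∈ Finset.range G.r, lam j • G.rate e j) +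
        α • G.mode e j ∈ G.region e := by
      have hlim : Tendsto (fun ε : ℝ => G.pt (G.onEdge e s)
          (D + ∑ j ∈ Finset.range G.r, lam j • G.rate e j) + ε • G.mode e j) (𝓝[<] α)
          (𝓝 (G.pt (G.onEdge e s)
            (D + ∑ j ∈ Finset.range G.r, lam j • G.rate e j) + α • G.mode e j)) :=
        (Continuous.tendsto (by fun_prop) α).mono_left nhdsWithin_le_nhds
      refine (G.isClosed_region e).mem_of_tendsto hlim ?_
      filter_upwards [Ioo_mem_nhdsLT hα] with ε hε
      obtain ⟨e', he'⟩ := hstay ε hε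
      have h3 := he'
      rw [hdata] at h3
      have : e' = e := by
        refine G.edge_eq_of_pos h3 ?_ ?_
        · rw [onEdge_src]; linarith [hε.2]
        · rw [onEdge_tgt]; linarith [hε.1]
      exact this ▸ he'
    rw [hdata, heq, onEdge_one] at hmem
    rw [hdata, add_assoc, heq, onEdge_one]
    have := hQ.step (lam' α) h hnn ((hsum α).trans heq) hr hmem
    have h4 := OnPath.vertex (G := G) this
    rwa [Nat.cast_succ] at h4

theorem OnPath.move {Q : ℕ → V → (δ → ℝ) → Prop} (hQ : G.Closed Q) {t α : ℝ} {p : Fin d → ℝ}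
    (h : G.OnPath Q t p) {e : E} {j : ℕ} (hj : j < G.r) (hα : 0 < α)
    (hstay : ∀ ε ∈ Set.Ioo 0 α, ∃ e', p + ε • G.mode e j ∈ G.region e') :
    G.OnPath Q (t + α) (p + α • G.mode e j) := by
  cases h with
  | @vertex k v D h =>
    obtain ⟨rfl, hr⟩ := G.of_vertex hα hstay
    have h5 := OnPath.along hQ (lam := 0) (s := 0) (α := α) h hr (fun _ => le_rfl) (by simp)
      le_rfl one_pos hj hα (by simpa [onEdge_zero] using hstay)
    simpa [onEdge_zero] using h5
  | edge h hr hlam hs h0 h1 =>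
    obtain rfl := G.edge_eq_of_interior h0 h1 hα hstay
    exact OnPath.along hQ h hr hlam hs h0.le h1 hj hα hstay

variable {M : MMS d}

/-- Only times before `T` are constrained, because an until formula asks nothing of its left operand
at the final time. -/
theorem onPath_point {Q : ℕ → V → (δ → ℝ) → Prop} (hQ : G.Closed Q)
    (hM : ∀ m ∈ M, ∃ e, ∃ j < G.r, m = G.mode e j) (π : Schedule M) {x : Fin d → ℝ}
    (hx : G.OnPath Q 0 x) {T : ℝ}
    (hstay : ∀ τ ∈ (π.induced x).dom, τ < T → ∃ e, (π.induced x).val τ ∈ G.region e) (n : ℕ)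
    (hn : (π.induced x).time n ≤ T) :
    G.OnPath Q ((π.induced x).time n) ((π.induced x).point n) := by
  induction n with
  | zero => simpa [Schedule.induced] using hx
  | succ n ih =>
    rw [π.induced_time_succ x n] at hn ⊢
    rw [π.induced_point_succ x n]
    have hd := π.dur_pos n
    obtain ⟨e, j, hj, hm⟩ := hM _ (π.mode_mem n)
    have h1 := ih (by linarith)
    rw [hm]
    refine h1.move hQ hj hd fun ε hε => ?_
    have h2 : (π.induced x).time n + ε ∈
        Set.Icc ((π.induced x).time n) ((π.induced x).time (n + 1)) := by
      rw [π.induced_time_succ]; constructor <;> linarith [hε.1, hε.2]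
    obtain ⟨e', he'⟩ := hstay _ (Set.mem_iUnion.2 ⟨n, h2⟩) (by linarith [hε.2])
    rw [π.induced_val x h2, add_sub_cancel_left, hm] at he'
    exact ⟨e', he'⟩

/-- An execution that stays in the regions of the edges follows a path of the graph. -/
theorem onPath_val {Q : ℕ → V → (δ → ℝ) → Prop} (hQ : G.Closed Q)
    (hM : ∀ m ∈ M, ∃ e, ∃ j < G.r, m = G.mode e j) (π : Schedule M) {x : Fin d → ℝ}
    (hx : G.OnPath Q 0 x) {T : ℝ} (hT : T ∈ (π.induced x).dom)
    (hstay : ∀ τ ∈ (π.induced x).dom, τ < T → ∃ e, (π.induced x).val τ ∈ G.region e) :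
    G.OnPath Q T ((π.induced x).val T) := by
  obtain ⟨n, hn⟩ := Set.mem_iUnion.1 hT
  have h1 := onPath_point hQ hM π hx hstay n hn.1
  rw [π.induced_val x hn]
  obtain ⟨e, j, hj, hm⟩ := hM _ (π.mode_mem n)
  rcases hn.1.eq_or_lt with h2 | h2
  · rw [← h2]; simpa using h1
  · have h3 := h1.move hQ (e := e) hj (sub_pos.2 h2) fun ε hε => ?_
    · rw [hm]; simpa using h3
    have h4 : (π.induced x).time n + ε ∈
        Set.Icc ((π.induced x).time n) ((π.induced x).time (n + 1)) :=
      ⟨by linarith [hε.1], by linarith [hε.2, hn.2]⟩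
    obtain ⟨e', he'⟩ := hstay _ (Set.mem_iUnion.2 ⟨n, h4⟩) (by linarith [hε.2])
    rw [π.induced_val x h4, add_sub_cancel_left, hm] at he'
    exact ⟨e', he'⟩


/-! ### Schedules that follow a given path -/

variable {d : ℕ} {V E δ : Type} [DecidableEq V] {G : ControlGraph d V E δ} {M : MMS d}

/-- The schedule that follows a sequence of edges, and uses each mode of the `k`-th edge once, for
the given durations. -/
def pathSchedule (hM : ∀ e, ∀ j < G.r, G.mode e j ∈ M) (hr : 0 < G.r) (edge : ℕ → E)
    (lam : ℕ → ℕ → ℝ) (hlam : ∀ k, ∀ j < G.r, 0 < lam k j) : Schedule M where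
  dur n := lam (n / G.r) (n % G.r)
  mode n := G.mode (edge (n / G.r)) (n % G.r)
  dur_pos _ := hlam _ _ (Nat.mod_lt _ hr)
  mode_mem _ := hM _ _ (Nat.mod_lt _ hr)

theorem exists_mem_Icc_succ {f : ℕ → ℝ} {r : ℕ} {τ : ℝ} (h : τ ∈ Set.Icc (f 0) (f r))
    (hr : 0 < r) : ∃ j < r, τ ∈ Set.Icc (f j) (f (j + 1)) := by
  induction r with
  | zero => omega
  | succ r ih =>
    rcases le_or_gt (f r) τ with h1 | h1
    · exact ⟨r, Nat.lt_succ_self r, h1, h.2⟩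
    · rcases Nat.eq_zero_or_pos r with rfl | h2
      · exact absurd h.1 h1.not_ge
      · obtain ⟨j, hj, hj'⟩ := ih ⟨h.1, h1.le⟩ h2
        exact ⟨j, hj.trans (Nat.lt_succ_self r), hj'⟩

section

variable (hM : ∀ e, ∀ j < G.r, G.mode e j ∈ M) (hr : 0 < G.r) {edge : ℕ → E}
  {lam : ℕ → ℕ → ℝ} (hlam : ∀ k, ∀ j < G.r, 0 < lam k j)

theorem pathSchedule_time (hsum : ∀ k, ∑ j ∈ Finset.range G.r, lam k j = 1) (x : Fin d → ℝ)
    (k j : ℕ) (hj : j ≤ G.r) :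
    ((pathSchedule hM hr edge lam hlam).induced x).time (k * G.r + j) =
      k + ∑ i ∈ Finset.range j, lam k i := by
  induction k generalizing j with
  | zero =>
    induction j with
    | zero => simp [Execution.time_zero]
    | succ j ih =>
      rw [← add_assoc, Schedule.induced_time_succ, ih (by omega), Finset.sum_range_succ, ← add_assoc]
      congr 1
      simp only [pathSchedule]
      rw [Nat.zero_mul, Nat.zero_add, Nat.div_eq_of_lt (by omega), Nat.mod_eq_of_lt (by omega)]
  | succ k ihk =>
    induction j with
    | zero =>
      have := ihk G.r le_rfl
      rw [hsum] at this
      rw [add_zero, Nat.succ_mul, this]; simp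
    | succ j ih =>
      rw [← add_assoc, Schedule.induced_time_succ, ih (by omega), Finset.sum_range_succ, ← add_assoc]
      congr 1
      simp only [pathSchedule]
      rw [mul_comm, Nat.mul_add_div hr, Nat.div_eq_of_lt (by omega), Nat.mul_add_mod,
        Nat.mod_eq_of_lt (by omega), add_zero]

theorem pathSchedule_nonZeno (hsum : ∀ k, ∑ j ∈ Finset.range G.r, lam k j = 1) :
    (pathSchedule hM hr edge lam hlam).NonZeno := by
  refine tendsto_atTop_atTop_of_monotone
    ((pathSchedule hM hr edge lam hlam).induced 0).time_strictMono.monotone fun b => ?_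
  obtain ⟨k, hk⟩ := exists_nat_ge b
  refine ⟨k * G.r + 0, hk.trans ?_⟩
  have := pathSchedule_time hM hr (edge := edge) hlam hsum 0 k 0 (Nat.zero_le _)
  change _ ≤ ((pathSchedule hM hr edge lam hlam).induced 0).time (k * G.r + 0)
  rw [this]; simp

theorem pathSchedule_point (hsum : ∀ k, ∑ j ∈ Finset.range G.r, lam k j = 1)
    (hedge : ∀ k, G.tgt (edge k) = G.src (edge (k + 1))) {D : ℕ → δ → ℝ} {N : ℕ}
    (hD : ∀ k < N, D (k + 1) =
      D k + ∑ j ∈ Finset.range G.r, lam k j • G.rate (edge k) j)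
    (k j : ℕ) (hk : k ≤ N) (hj : j ≤ G.r) :
    ((pathSchedule hM hr edge lam hlam).induced
      (G.pt (atVertex (G.src (edge 0))) (D 0))).point (k * G.r + j) =
      G.pt (G.onEdge (edge k) (∑ i ∈ Finset.range j, lam k i))
        (D k + ∑ i ∈ Finset.range j, lam k i • G.rate (edge k) i) := by
  have step : ∀ k j, j + 1 ≤ G.r → ((pathSchedule hM hr edge lam hlam).induced
      (G.pt (atVertex (G.src (edge 0))) (D 0))).point (k * G.r + j) =
      G.pt (G.onEdge (edge k) (∑ i ∈ Finset.range j, lam k i))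
        (D k + ∑ i ∈ Finset.range j, lam k i • G.rate (edge k) i) →
      ((pathSchedule hM hr edge lam hlam).induced
      (G.pt (atVertex (G.src (edge 0))) (D 0))).point (k * G.r + (j + 1)) =
      G.pt (G.onEdge (edge k) (∑ i ∈ Finset.range (j + 1), lam k i))
        (D k + ∑ i ∈ Finset.range (j + 1), lam k i • G.rate (edge k) i) := by
    intro k j hj h
    rw [← add_assoc, Schedule.induced_point_succ, h]
    simp only [pathSchedule]
    rw [mul_comm, Nat.mul_add_div hr, Nat.div_eq_of_lt (by omega), Nat.mul_add_mod,
      Nat.mod_eq_of_lt (by omega), add_zero, mode, pt_add_smul, onEdge_add, Finset.sum_range_succ,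
      Finset.sum_range_succ, add_assoc]
  induction k generalizing j with
  | zero =>
    induction j with
    | zero => simp [Schedule.induced, onEdge_zero]
    | succ j ih => exact step _ _ hj (ih (by omega))
  | succ k ihk =>
    induction j with
    | zero =>
      have := ihk G.r (by omega) le_rfl
      rw [hsum, onEdge_one] at this
      rw [add_zero, Nat.succ_mul, this, hD k (by omega), hedge]
      simp [onEdge_zero]
    | succ j ih => exact step _ _ hj (ih (by omega))

/-- The execution is affine between consecutive uses of modes and the region is convex, so the
breakpoints suffice. -/
theorem pathSchedule_mem_region (hsum : ∀ k, ∑ j ∈ Finset.range G.r, lam k j = 1)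
    (hedge : ∀ k, G.tgt (edge k) = G.src (edge (k + 1))) {D : ℕ → δ → ℝ} {N : ℕ}
    (hD : ∀ k < N, D (k + 1) =
      D k + ∑ j ∈ Finset.range G.r, lam k j • G.rate (edge k) j) {k : ℕ} (hk : k < N)
    (hreg : ∀ j ≤ G.r, G.pt (G.onEdge (edge k) (∑ i ∈ Finset.range j, lam k i))
        (D k + ∑ i ∈ Finset.range j, lam k i • G.rate (edge k) i) ∈ G.region (edge k))
    {τ : ℝ} (hτ : τ ∈ Set.Icc (k : ℝ) (k + 1)) :
    ((pathSchedule hM hr edge lam hlam).induced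
      (G.pt (atVertex (G.src (edge 0))) (D 0))).val τ ∈ G.region (edge k) := by
  set σ := (pathSchedule hM hr edge lam hlam).induced
      (G.pt (atVertex (G.src (edge 0))) (D 0)) with hσ
  obtain ⟨j, hj, hj'⟩ := exists_mem_Icc_succ (f := fun j => σ.time (k * G.r + j)) (r := G.r)
    (τ := τ) (by
      simp only [hσ]
      rw [pathSchedule_time hM hr hlam hsum _ _ _ (Nat.zero_le _),
        pathSchedule_time hM hr hlam hsum _ _ _ le_rfl, hsum]
      simpa using hτ) hr
  simp only [← add_assoc] at hj'
  have h1 := σ.val_eq_interp hj'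
  rw [h1, Execution.interp]
  have hlt := σ.time_strictMono (Nat.lt_succ_self (k * G.r + j))
  have p1 : σ.point (k * G.r + j) ∈ G.region (edge k) := by
    simp only [hσ]
    rw [pathSchedule_point hM hr hlam hsum hedge hD k j hk.le hj.le]
    exact hreg j hj.le
  have p2 : σ.point (k * G.r + j + 1) ∈ G.region (edge k) := by
    simp only [hσ]
    rw [add_assoc, pathSchedule_point hM hr hlam hsum hedge hD k (j + 1) hk.le hj]
    exact hreg (j + 1) hj
  have hd : 0 < σ.time (k * G.r + j + 1) - σ.time (k * G.r + j) := sub_pos.2 hlt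
  refine (G.convex_region _).add_smul_sub_mem p1 p2 ⟨?_, ?_⟩
  · exact div_nonneg (sub_nonneg.2 hj'.1) hd.le
  · rw [div_le_one hd]; linarith [hj'.2]

theorem pathSchedule_mem_dom (hsum : ∀ k, ∑ j ∈ Finset.range G.r, lam k j = 1)
    (x : Fin d → ℝ) {τ : ℝ} (hτ : 0 ≤ τ) :
    τ ∈ ((pathSchedule hM hr edge lam hlam).induced x).dom := by
  have hτ' : τ ∈ Set.Icc (⌊τ⌋₊ : ℝ) (⌊τ⌋₊ + 1) :=
    ⟨Nat.floor_le hτ, (Nat.lt_floor_add_one τ).le⟩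
  set k := ⌊τ⌋₊
  obtain ⟨j, hj, hj'⟩ := exists_mem_Icc_succ
    (f := fun j => ((pathSchedule hM hr edge lam hlam).induced x).time (k * G.r + j)) (r := G.r)
    (τ := τ) (by
      rw [pathSchedule_time hM hr hlam hsum _ _ _ (Nat.zero_le _),
        pathSchedule_time hM hr hlam hsum _ _ _ le_rfl, hsum]
      simpa using hτ') hr
  exact Set.mem_iUnion.2 ⟨_, hj'⟩

theorem pathSchedule_val_nat (hsum : ∀ k, ∑ j ∈ Finset.range G.r, lam k j = 1)
    (hedge : ∀ k, G.tgt (edge k) = G.src (edge (k + 1))) {D : ℕ → δ → ℝ} {N : ℕ}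
    (hD : ∀ k < N, D (k + 1) =
      D k + ∑ j ∈ Finset.range G.r, lam k j • G.rate (edge k) j) {k : ℕ} (hk : k ≤ N) :
    ((pathSchedule hM hr edge lam hlam).induced
      (G.pt (atVertex (G.src (edge 0))) (D 0))).val k =
        G.pt (atVertex (G.src (edge k))) (D k) := by
  have h1 := pathSchedule_time hM hr (edge := edge) hlam hsum
    (G.pt (atVertex (G.src (edge 0))) (D 0)) k 0 (Nat.zero_le _)
  have h2 := Schedule.induced_val_time (pathSchedule hM hr edge lam hlam)
    (G.pt (atVertex (G.src (edge 0))) (D 0)) (k * G.r + 0)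
  rw [h1, pathSchedule_point hM hr hlam hsum hedge hD k 0 hk (Nat.zero_le _)] at h2
  simpa [onEdge_zero] using h2

end

end ControlGraph

/-! ### Disjunctions and nested untils of zones -/

section Formulas

variable {d : ℕ}

namespace LTL

/-- The disjunction of a list of zones. -/
def orList (Z₀ : Zone d) (l : List (Zone d)) : LTL d :=
  l.foldr (fun Z φ => .or (.zone Z) φ) (.zone Z₀)

/-- The formula `Z₁ U (Z₂ U (⋯ U Z₀))`. -/
def untilList (Z₀ : Zone d) (l : List (Zone d)) : LTL d :=
  l.foldr (fun Z φ => .U (.zone Z) φ) (.zone Z₀)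

theorem sat_orList {σ : Execution d} {Z₀ : Zone d} {l : List (Zone d)} {τ : ℝ} :
    Sat σ (orList Z₀ l) τ ↔ ∃ Z ∈ Z₀ :: l, σ.val τ ∈ Z.toSet := by
  induction l with
  | nil => simp [orList, Sat]
  | cons Z l ih =>
    change (_ ∨ Sat σ (orList Z₀ l) τ) ↔ _
    rw [ih]
    simp only [Sat, List.mem_cons, exists_eq_or_imp]
    tauto

/-- Either the outer until waits, and its zone holds now, or it is fulfilled at once and the inner
formula holds now. Hence a nested until can do the work of a disjunction. -/
theorem exists_mem_of_sat_untilList {σ : Execution d} {Z₀ : Zone d} {l : List (Zone d)} {τ : ℝ}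
    (h : Sat σ (untilList Z₀ l) τ) : ∃ Z ∈ Z₀ :: l, σ.val τ ∈ Z.toSet := by
  induction l with
  | nil => simpa [untilList, Sat] using h
  | cons Z l ih =>
    obtain ⟨τ', -, hle, h1, h2⟩ : ∃ τ' ∈ σ.dom, τ ≤ τ' ∧ Sat σ (untilList Z₀ l) τ' ∧
      ∀ τ'' ∈ Set.Ico τ τ', Sat σ (.zone Z) τ'' := h
    rcases hle.eq_or_lt with rfl | hlt
    · obtain ⟨Z', hZ', hm⟩ := ih h1
      refine ⟨Z', ?_, hm⟩
      simp only [List.mem_cons] at hZ' ⊢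
      tauto
    · exact ⟨Z, by simp, h2 τ ⟨le_rfl, hlt⟩⟩

/-- Each leading until is fulfilled at once, with an empty waiting interval. -/
theorem sat_untilList_append {σ : Execution d} {Z₀ : Zone d} (l₁ : List (Zone d))
    {l₂ : List (Zone d)} {τ : ℝ} (hτ : τ ∈ σ.dom) (h : Sat σ (untilList Z₀ l₂) τ) :
    Sat σ (untilList Z₀ (l₁ ++ l₂)) τ := by
  induction l₁ with
  | nil => exact h
  | cons Z l₁ ih => exact ⟨τ, hτ, le_rfl, ih, fun τ'' h => absurd h.2 h.1.not_gt⟩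

theorem sat_untilList_of_mem {σ : Execution d} {Z₀ Z : Zone d} {l₂ : List (Zone d)}
    {τ τ' : ℝ} (hτ' : τ' ∈ σ.dom) (hle : τ ≤ τ')
    (hZ : ∀ τ'' ∈ Set.Ico τ τ', σ.val τ'' ∈ Z.toSet) (h : Sat σ (untilList Z₀ l₂) τ') :
    Sat σ (untilList Z₀ (Z :: l₂)) τ :=
  ⟨τ', hτ', hle, h, hZ⟩

theorem sat_untilList_of_zone {σ : Execution d} {Z₀ : Zone d} (l : List (Zone d)) {τ : ℝ}
    (hτ : τ ∈ σ.dom) (h : σ.val τ ∈ Z₀.toSet) : Sat σ (untilList Z₀ l) τ := by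
  simpa using sat_untilList_append (σ := σ) (Z₀ := Z₀) l (l₂ := []) hτ h

theorem orList_mem_fragmentB {Z₀ : Zone d} {l : List (Zone d)}
    (h : ∀ Z ∈ Z₀ :: l, Bornology.IsBounded Z.toSet) :
    (orList Z₀ l).G ∈ fragmentB d {Op.G, Op.or} := by
  have h1 : (orList Z₀ l).operators ⊆ {Op.G, Op.or} ∧ ∀ Z ∈ (orList Z₀ l).zones, Z ∈ Z₀ :: l := by
    clear h
    induction l with
    | nil => simp [orList, operators, zones]
    | cons Z l ih =>
      change {Op.or} ∪ operators (.zone Z) ∪ operators (orList Z₀ l) ⊆ _ ∧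
        ∀ Z' ∈ zones (.zone Z) ∪ zones (orList Z₀ l), _
      refine ⟨by simp [operators, Set.insert_subset_iff, ih.1], ?_⟩
      rintro Z' (hZ | hZ)
      · simp only [zones, Set.mem_singleton_iff] at hZ; simp [hZ]
      · have := ih.2 Z' hZ
        simp only [List.mem_cons] at this ⊢
        tauto
  refine ⟨?_, fun Z hZ => h Z (h1.2 Z hZ)⟩
  simp [operators, Set.insert_subset_iff, h1.1]

theorem untilList_mem_fragmentB {Z₀ Z₁ : Zone d} {l : List (Zone d)}
    (h : ∀ Z ∈ Z₀ :: l, Bornology.IsBounded Z.toSet) (h1 : Bornology.IsBounded Z₁.toSet) :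
    (untilList Z₀ l).U (.zone Z₁) ∈ fragmentB d {Op.U} := by
  have h2 : (untilList Z₀ l).operators ⊆ {Op.U} ∧
      ∀ Z ∈ (untilList Z₀ l).zones, Z ∈ Z₀ :: l := by
    clear h
    induction l with
    | nil => simp [untilList, operators, zones]
    | cons Z l ih =>
      change {Op.U} ∪ operators (.zone Z) ∪ operators (untilList Z₀ l) ⊆ _ ∧
        ∀ Z' ∈ zones (.zone Z) ∪ zones (untilList Z₀ l), _
      refine ⟨by simpa [operators, Set.insert_subset_iff] using ih.1, ?_⟩
      rintro Z' (hZ | hZ)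
      · simp only [zones, Set.mem_singleton_iff] at hZ; simp [hZ]
      · have := ih.2 Z' hZ
        simp only [List.mem_cons] at this ⊢
        tauto
  refine ⟨by simpa [operators, Set.insert_subset_iff] using h2.1, ?_⟩
  rintro Z (hZ | hZ)
  · exact h Z (h2.2 Z hZ)
  · simp only [zones, Set.mem_singleton_iff] at hZ; exact hZ ▸ h1

end LTL

end Formulas

/-! ### Zones given by linear inequalities -/

section Zones

theorem Zone.isClosed_toSet {d : ℕ} (Z : Zone d) : IsClosed Z.toSet := by
  simp only [Zone.toSet, Set.ofPred_forall]
  exact isClosed_iInter fun i => isClosed_le (by fun_prop) continuous_const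

theorem Zone.convex_toSet {d : ℕ} (Z : Zone d) : Convex ℝ Z.toSet := by
  intro x hx y hy a b ha hb hab i
  have h1 := mul_le_mul_of_nonneg_left (hx i) ha
  have h2 := mul_le_mul_of_nonneg_left (hy i) hb
  rw [Finset.mul_sum] at h1 h2
  have h3 : ∑ j, (Z.A i j : ℝ) * (a • x + b • y) j =
      ∑ j, a * ((Z.A i j : ℝ) * x j) + ∑ j, b * ((Z.A i j : ℝ) * y j) := by
    rw [← Finset.sum_add_distrib]
    exact Finset.sum_congr rfl fun j _ => by simp; ring
  rw [h3]
  calc _ ≤ a * (Z.b i : ℝ) + b * (Z.b i : ℝ) := add_le_add h1 h2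
    _ = Z.b i := by rw [← add_mul, hab, one_mul]

variable {ι : Type} [Fintype ι] {d : ℕ}

/-- A linear inequality `∑ aᵢ xᵢ ≤ b`. -/
abbrev Ineq (ι : Type) := (ι → ℤ) × ℤ

/-- A point satisfies a linear inequality. -/
def Ineq.Holds (c : Ineq ι) (z : ι → ℝ) : Prop := ∑ i, (c.1 i : ℝ) * z i ≤ (c.2 : ℝ)

/-- The zone given by a list of linear inequalities in other coordinates. -/
def zoneOf (coord : ι ≃ Fin d) (l : List (Ineq ι)) : Zone d where
  k := l.length
  A i j := (l.get i).1 (coord.symm j)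
  b i := (l.get i).2

theorem mem_zoneOf {coord : ι ≃ Fin d} {l : List (Ineq ι)} {z : Fin d → ℝ} :
    z ∈ (zoneOf coord l).toSet ↔ ∀ c ∈ l, Ineq.Holds c (z ∘ coord) := by
  have h : ∀ c : Ineq ι, ∑ j, (c.1 (coord.symm j) : ℝ) * z j = ∑ i, (c.1 i : ℝ) * (z ∘ coord) i := by
    intro c
    rw [← coord.sum_comp]; simp
  rw [List.forall_mem_iff_get]
  simp only [Zone.toSet, zoneOf, Set.mem_ofPred_eq, h, Ineq.Holds]

variable [DecidableEq ι]

/-- The inequality `xᵢ ≤ b`. -/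
def Ineq.le (i : ι) (b : ℤ) : Ineq ι := (Pi.single i 1, b)

/-- The inequality `b ≤ xᵢ`. -/
def Ineq.ge (i : ι) (b : ℤ) : Ineq ι := (Pi.single i (-1), -b)

/-- The inequality `xᵢ ≤ a * xⱼ`. -/
def Ineq.leMul (i j : ι) (a : ℤ) : Ineq ι := (Pi.single i 1 - Pi.single j a, 0)

theorem Ineq.sum_single (i : ι) (a : ℤ) (z : ι → ℝ) :
    ∑ k, ((Pi.single i a : ι → ℤ) k : ℝ) * z k = a * z i := by
  simp [Pi.single_apply]

@[simp] theorem Ineq.holds_le {i : ι} {b : ℤ} {z : ι → ℝ} :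
    (Ineq.le i b).Holds z ↔ z i ≤ b := by
  simp [Ineq.Holds, Ineq.le, Ineq.sum_single]

@[simp] theorem Ineq.holds_ge {i : ι} {b : ℤ} {z : ι → ℝ} :
    (Ineq.ge i b).Holds z ↔ (b : ℝ) ≤ z i := by
  simp [Ineq.Holds, Ineq.ge, Ineq.sum_single]

@[simp] theorem Ineq.holds_leMul {i j : ι} {a : ℤ} {z : ι → ℝ} :
    (Ineq.leMul i j a).Holds z ↔ z i ≤ a * z j := by
  simp [Ineq.Holds, Ineq.leMul, Ineq.sum_single, sub_mul, Finset.sum_sub_distrib]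

/-- The inequalities `-R ≤ xᵢ ≤ R`. -/
noncomputable def Ineq.box (ι : Type) [Fintype ι] [DecidableEq ι] (R : ℕ) : List (Ineq ι) :=
  Finset.univ.toList.map (fun i : ι => Ineq.le i R) ++
    Finset.univ.toList.map (fun i : ι => Ineq.ge i (-R))

theorem Ineq.forall_mem_box {R : ℕ} {z : ι → ℝ} :
    (∀ c ∈ Ineq.box ι R, Ineq.Holds c z) ↔ ∀ i, |z i| ≤ R := by
  simp only [Ineq.box, List.forall_mem_append, List.forall_mem_map, Finset.mem_toList,
    Finset.mem_univ, forall_const, Ineq.holds_le, Ineq.holds_ge, abs_le]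
  push_cast
  exact ⟨fun h i => ⟨h.2 i, h.1 i⟩, fun h => ⟨fun i => (h i).2, fun i => (h i).1⟩⟩

theorem isBounded_zoneOf_box (coord : ι ≃ Fin d) (R : ℕ) (l : List (Ineq ι)) :
    Bornology.IsBounded (zoneOf coord (Ineq.box ι R ++ l)).toSet := by
  refine (Metric.isBounded_Icc (fun _ => -(R : ℝ)) (fun _ => (R : ℝ))).subset fun z hz => ?_
  rw [mem_zoneOf, List.forall_mem_append, Ineq.forall_mem_box] at hz
  have h : ∀ j, |z j| ≤ R := fun j => by simpa using hz.1 (coord.symm j)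
  exact ⟨fun j => (abs_le.1 (h j)).1, fun j => (abs_le.1 (h j)).2⟩

end Zones


/-! ### Affine systems and their control graphs -/

/-- A system on `ℝ^m` of finitely many affine maps `x ↦ F x + b`, each of which may be applied in a
polyhedron. The constants `K` and `R` bound the points and the entries of the maps. -/
structure AffineSystem (m : ℕ) (T : Type) where
  guard : T → List (Ineq (Fin m))
  F : T → Fin m → Fin m → ℚ
  b : T → Fin m → ℚ
  K : ℕ
  R : ℕ
  K_pos : 0 < K
  K_le_R : K ≤ R
  bound : ∀ t i, ∑ j, |F t i j| * K + |b t i| ≤ R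

namespace AffineSystem

variable {m : ℕ} {T : Type} (S : AffineSystem m T)

/-- The image of a point under one of the affine maps. -/
def apply (t : T) (x : Fin m → ℝ) : Fin m → ℝ := fun i => ∑ j, (S.F t i j : ℝ) * x j + S.b t i

/-- The map `t` may be applied to `x`. -/
def Enabled (t : T) (x : Fin m → ℝ) : Prop := ∀ c ∈ S.guard t, Ineq.Holds c x

/-- The points that are reached from `x₀` in a given number of steps. -/
inductive Reach (x₀ : Fin m → ℝ) : ℕ → (Fin m → ℝ) → Prop
  | zero : Reach x₀ 0 x₀
  | succ {n x} (t : T) (h : Reach x₀ n x) (ht : S.Enabled t x) : Reach x₀ (n + 1) (S.apply t x)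

/-- The vertices of the control graph: `inl false` and `inl true`, where the current point of the
system is stored in the first, respectively second half of the data, and one vertex for each
affine map. -/
abbrev Vertex (T : Type) := Bool ⊕ T

/-- The edges of the control graph: for each affine map `t`, one that checks the guard and one that
applies the map; and one edge that copies the point back. -/
abbrev Edge (T : Type) := Option (Bool × T)

/-- All coordinates: control and data. -/
abbrev Coord (m : ℕ) (T : Type) := Vertex T ⊕ (Fin m ⊕ Fin m)

/-- The source of an edge. -/
def src : Edge T → Vertex T
  | none => .inl true
  | some (false, _) => .inl false
  | some (true, t) => .inr t

/-- The target of an edge. -/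
def tgt : Edge T → Vertex T
  | none => .inl false
  | some (false, t) => .inr t
  | some (true, _) => .inl true

/-- The rates of change of the data along an edge. -/
def rate : Edge T → ℕ → Fin m ⊕ Fin m → ℚ
  | some (false, _), _ => 0
  -- Using mode `j < m` for time `x j / K` empties coordinate `j` and adds `F t i j * x j` to
  -- coordinate `i` of the second half. The constant `b t i` accrues in every mode, for one unit of
  -- time in all; mode `m` fills the remaining time.
  | some (true, t), j => Sum.elim (fun i => if (i : ℕ) = j then -(S.K : ℚ) else 0)
      (fun i => S.b t i + if h : j < m then S.K * S.F t i ⟨j, h⟩ else 0)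
  | none, j => Sum.elim (fun i => if (i : ℕ) = j then (S.K : ℚ) else 0)
      (fun i => if (i : ℕ) = j then -(S.K : ℚ) else 0)

/-- An inequality on the first half of the data. -/
def embed (c : Ineq (Fin m)) : Ineq (Coord m T) := (Sum.elim 0 (Sum.elim c.1 0), c.2)

variable [Fintype T]

theorem holds_embed {c : Ineq (Fin m)} {z : Coord m T → ℝ} :
    (embed c).Holds z ↔ c.Holds fun i => z (.inr (.inl i)) := by
  simp [Ineq.Holds, embed, Fintype.sum_sum_type]

variable [DecidableEq T]

/-- The specific inequalities on the data along an edge. -/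
noncomputable def dataIneqs : Edge T → List (Ineq (Coord m T))
  | some (false, t) => (S.guard t).map embed
  -- The control at the source falls to 0 along the edge, so the upper bound forces the coordinates
  -- to be empty at the end.
  | some (true, t) => Finset.univ.toList.map (fun i => Ineq.ge (.inr (.inl i)) 0) ++
      Finset.univ.toList.map (fun i => Ineq.leMul (.inr (.inl i)) (.inl (.inr t)) S.K)
  | none => Finset.univ.toList.map (fun i => Ineq.ge (.inr (.inr i)) 0) ++
      Finset.univ.toList.map (fun i => Ineq.leMul (.inr (.inr i)) (.inl (.inl true)) S.K)

/-- The inequalities on the control along an edge. -/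
noncomputable def controlIneqs (e : Edge T) : List (Ineq (Coord m T)) :=
  Finset.univ.toList.map (fun v => Ineq.ge (.inl v) 0) ++
    (Finset.univ.toList.filter fun v => v ≠ src e ∧ v ≠ tgt e).map fun v => Ineq.le (.inl v) 0

/-- The coordinates, in some order. -/
noncomputable def coord (m : ℕ) (T : Type) [Fintype T] :
    Coord m T ≃ Fin (Fintype.card (Coord m T)) := Fintype.equivFin _

/-- The zone in which an edge is traversed. -/
noncomputable def edgeZone (e : Edge T) : Zone (Fintype.card (Coord m T)) :=
  zoneOf (coord m T) (Ineq.box _ S.R ++ (controlIneqs e ++ S.dataIneqs e))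

/-- The conditions on the data along an edge. -/
def DataCond : Edge T → (Vertex T → ℝ) → (Fin m ⊕ Fin m → ℝ) → Prop
  | some (false, t), _, D => S.Enabled t fun i => D (.inl i)
  | some (true, t), c, D => ∀ i, 0 ≤ D (.inl i) ∧ D (.inl i) ≤ S.K * c (.inr t)
  | none, c, D => ∀ i, 0 ≤ D (.inr i) ∧ D (.inr i) ≤ S.K * c (.inl true)

theorem mem_edgeZone {e : Edge T} {z : Fin (Fintype.card (Coord m T)) → ℝ} :
    z ∈ (S.edgeZone e).toSet ↔ (∀ i, |z i| ≤ S.R) ∧ (∀ v, 0 ≤ z (coord m T (.inl v))) ∧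
      (∀ v, v ≠ src e → v ≠ tgt e → z (coord m T (.inl v)) ≤ 0) ∧
      S.DataCond e (fun v => z (coord m T (.inl v))) fun i => z (coord m T (.inr i)) := by
  rw [edgeZone, mem_zoneOf, List.forall_mem_append, List.forall_mem_append, Ineq.forall_mem_box]
  refine and_congr ?_ ?_
  · exact (coord m T).forall_congr_left.trans (by simp)
  rw [← and_assoc]
  refine and_congr ?_ ?_
  · simp only [controlIneqs, List.forall_mem_append, List.forall_mem_map, List.mem_filter,
      Finset.mem_toList, Finset.mem_univ, true_and, forall_const, decide_eq_true_eq, and_imp,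
      Ineq.holds_ge, Ineq.holds_le, Int.cast_zero, Function.comp_apply]
  · rcases e with _ | ⟨_ | _, t⟩
    · simp [dataIneqs, DataCond, or_imp, forall_and]
    · simp only [dataIneqs, DataCond, Enabled, List.forall_mem_map, holds_embed]
      rfl
    · simp [dataIneqs, DataCond, or_imp, forall_and]

/-- The control graph of the system. -/
noncomputable def graph : ControlGraph (Fintype.card (Coord m T)) (Vertex T) (Edge T)
    (Fin m ⊕ Fin m) where
  coord := coord m T
  src := src
  tgt := tgt
  src_ne_tgt e := by rcases e with _ | ⟨_ | _, t⟩ <;> simp [src, tgt]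
  edge_inj {e e'} := by
    rcases e with _ | ⟨_ | _, t⟩ <;> rcases e' with _ | ⟨_ | _, t'⟩ <;> simp [src, tgt]
  not_antiparallel {e e'} := by
    rcases e with _ | ⟨_ | _, t⟩ <;> rcases e' with _ | ⟨_ | _, t'⟩ <;> simp [src, tgt]
  r := m + 1
  rate e j i := (S.rate e j i : ℝ)
  region e := (S.edgeZone e).toSet
  isClosed_region e := Zone.isClosed_toSet _
  convex_region e := Zone.convex_toSet _
  control_nonneg h := (S.mem_edgeZone.1 h).2.1
  control_nonpos h := (S.mem_edgeZone.1 h).2.2.1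

/-- The modes, as rational vectors. -/
noncomputable def modeQ (e : Edge T) (j : ℕ) : Fin (Fintype.card (Coord m T)) → ℚ := fun i =>
  Sum.elim (fun v => (if v = tgt e then 1 else 0) - (if v = src e then 1 else 0)) (S.rate e j)
    ((coord m T).symm i)

theorem toReal_modeQ (e : Edge T) (j : ℕ) : toReal (S.modeQ e j) = S.graph.mode e j := by
  funext i
  simp only [toReal, modeQ, ControlGraph.mode, ControlGraph.pt, graph]
  cases (coord m T).symm i with
  | inl v => simp [Pi.single_apply]; split_ifs <;> simp
  | inr i => simp

/-- The list of all modes. -/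
noncomputable def modes : List (Fin (Fintype.card (Coord m T)) → ℚ) :=
  (Finset.univ.toList ×ˢ List.range (m + 1)).map fun p => S.modeQ p.1 p.2

/-- The initial point, as a rational vector. -/
noncomputable def start (x : Fin m → ℚ) : Fin (Fintype.card (Coord m T)) → ℚ := fun i =>
  Sum.elim (fun v => if v = .inl false then 1 else 0) (Sum.elim x 0) ((coord m T).symm i)

/-- The data for a point `x`, respectively `y` in either half. -/
def dat (x y : Fin m → ℝ) : Fin m ⊕ Fin m → ℝ := Sum.elim x y

theorem toReal_start (x : Fin m → ℚ) : toReal (start (T := T) x) =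
    S.graph.pt (ControlGraph.atVertex (.inl false)) (dat (fun i => (x i : ℝ)) 0) := by
  funext i
  simp only [toReal, start, ControlGraph.pt, graph, ControlGraph.atVertex, dat]
  rcases (coord m T).symm i with v | i | i <;> simp [Pi.single_apply, apply_ite]

theorem pt_mem_edgeZone {e : Edge T} {c : Vertex T → ℝ} {D : Fin m ⊕ Fin m → ℝ} :
    S.graph.pt c D ∈ (S.edgeZone e).toSet ↔ (∀ v, |c v| ≤ S.R) ∧ (∀ i, |D i| ≤ S.R) ∧
      (∀ v, 0 ≤ c v) ∧ (∀ v, v ≠ src e → v ≠ tgt e → c v ≤ 0) ∧ S.DataCond e c D := by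
  have h1 : ∀ v, S.graph.pt c D (coord m T (.inl v)) = c v := S.graph.pt_inl c D
  have h2 : ∀ i, S.graph.pt c D (coord m T (.inr i)) = D i := S.graph.pt_inr c D
  rw [mem_edgeZone, ← (coord m T).forall_congr_right, Sum.forall]
  simp only [h1, h2, and_assoc]

/-- The zone of the points at the vertex `inl false` whose data satisfy further inequalities. -/
noncomputable def finalZone (H : List (Ineq (Fin m))) : Zone (Fintype.card (Coord m T)) :=
  zoneOf (coord m T) (Ineq.box _ S.R ++ (Ineq.ge (.inl (.inl false)) 1 :: H.map embed))

theorem pt_mem_finalZone {H : List (Ineq (Fin m))} {c : Vertex T → ℝ} {D : Fin m ⊕ Fin m → ℝ} :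
    S.graph.pt c D ∈ (S.finalZone H).toSet ↔ (∀ v, |c v| ≤ S.R) ∧ (∀ i, |D i| ≤ S.R) ∧
      1 ≤ c (.inl false) ∧ ∀ h ∈ H, Ineq.Holds h fun i => D (.inl i) := by
  have h1 : ∀ v, S.graph.pt c D (coord m T (.inl v)) = c v := S.graph.pt_inl c D
  have h2 : ∀ i, S.graph.pt c D (coord m T (.inr i)) = D i := S.graph.pt_inr c D
  rw [finalZone, mem_zoneOf, List.forall_mem_append, Ineq.forall_mem_box]
  rw [List.forall_mem_cons, List.forall_mem_map, Sum.forall]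
  simp only [holds_embed, Ineq.holds_ge, Function.comp_apply, h1, h2, and_assoc, Int.cast_one]

/-- The zones for the guards, followed by the zones for the maps. -/
noncomputable def stepZones : List (Zone (Fintype.card (Coord m T))) :=
  Finset.univ.toList.map (fun t => S.edgeZone (some (false, t))) ++
    Finset.univ.toList.map (fun t => S.edgeZone (some (true, t)))

theorem mem_zones {Z : Zone (Fintype.card (Coord m T))} :
    Z ∈ S.edgeZone none :: S.stepZones ↔ ∃ e, Z = S.edgeZone e := by
  simp only [stepZones, List.mem_cons, List.mem_append, List.mem_map, Finset.mem_toList,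
    Finset.mem_univ, true_and, Option.exists, Prod.exists, Bool.exists_bool, eq_comm]

theorem isBounded_edgeZone (e : Edge T) : Bornology.IsBounded (S.edgeZone e).toSet :=
  isBounded_zoneOf_box _ _ _

theorem isBounded_finalZone (H : List (Ineq (Fin m))) :
    Bornology.IsBounded (S.finalZone (T := T) H).toSet :=
  isBounded_zoneOf_box _ _ _

/-- The input that asks whether the system has an infinite run. -/
noncomputable def inputG [Nonempty T] (x : Fin m → ℚ) : MCInput where
  d := Fintype.card (Coord m T)
  one_le_d := Fintype.card_pos
  modes := S.modes
  start := start x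
  formula := .G (LTL.orList (S.edgeZone none) S.stepZones)

/-- The input that asks whether the system has a run to a given polyhedron. -/
noncomputable def inputU [Nonempty T] (H : List (Ineq (Fin m))) (x : Fin m → ℚ) : MCInput where
  d := Fintype.card (Coord m T)
  one_le_d := Fintype.card_pos
  modes := S.modes
  start := start x
  formula := .U (LTL.untilList (S.edgeZone none) S.stepZones) (.zone (S.finalZone H))

theorem inputG_mem [Nonempty T] (x : Fin m → ℚ) :
    (S.inputG x).formula ∈ LTL.fragmentB (S.inputG x).d {Op.G, Op.or} :=
  LTL.orList_mem_fragmentB fun Z hZ => by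
    obtain ⟨e, rfl⟩ := S.mem_zones.1 hZ
    exact S.isBounded_edgeZone e

theorem inputU_mem [Nonempty T] (H : List (Ineq (Fin m))) (x : Fin m → ℚ) :
    (S.inputU H x).formula ∈ LTL.fragmentB (S.inputU H x).d {Op.U} :=
  LTL.untilList_mem_fragmentB (fun Z hZ => by
    obtain ⟨e, rfl⟩ := S.mem_zones.1 hZ
    exact S.isBounded_edgeZone e) (S.isBounded_finalZone H)

open Classical in
theorem mem_mms {z : Fin (Fintype.card (Coord m T)) → ℝ} :
    z ∈ (S.modes.map toReal).toFinset ↔ ∃ e, ∃ j < S.graph.r, z = S.graph.mode e j := by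
  simp only [modes, List.map_map, List.mem_toFinset, List.mem_map, Prod.exists,
    List.mem_product, Finset.mem_toList, Finset.mem_univ, true_and, List.mem_range,
    Function.comp_apply, toReal_modeQ]
  refine exists_congr fun e => exists_congr fun j => ?_
  exact and_congr Iff.rfl eq_comm

end AffineSystem

/-! ### From executions to runs of the affine system -/

theorem ControlGraph.OnPath.exists_vertex {d : ℕ} {V E δ : Type} [DecidableEq V]
    {G : ControlGraph d V E δ} {Q : ℕ → V → (δ → ℝ) → Prop} {t : ℝ} {p : Fin d → ℝ}
    (h : G.OnPath Q t p) : ∃ k v D, Q k v D ∧ t < k + 1 := by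
  cases h with
  | vertex h => exact ⟨_, _, _, h, by simp⟩
  | edge h _ _ _ _ h1 => exact ⟨_, _, _, h, by linarith⟩

namespace AffineSystem

open ControlGraph

variable {m : ℕ} {T : Type} (S : AffineSystem m T)

theorem sum_mul_ite_eq (lam : ℕ → ℝ) (a : ℝ) (i j' : ℕ) :
    ∑ j ∈ Finset.range j', lam j * (if i = j then a else 0) =
      if i < j' then lam i * a else 0 := by
  simp [mul_ite, Finset.sum_ite_eq]

theorem sum_mul_dite (lam : ℕ → ℝ) (F : Fin m → ℝ) :
    ∑ j ∈ Finset.range (m + 1), lam j * (if h : j < m then F ⟨j, h⟩ else 0) =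
      ∑ j : Fin m, lam j * F j := by
  rw [Finset.sum_range_succ, Finset.sum_range]
  simp

/-- The data that may be seen at each vertex after a given number of edges. -/
inductive Stage (x₀ : Fin m → ℝ) : ℕ → Vertex T → (Fin m ⊕ Fin m → ℝ) → Prop
  | fst {n x} (h : S.Reach x₀ n x) : Stage x₀ (3 * n) (.inl false) (dat x 0)
  | mid {n x t} (h : S.Reach x₀ n x) (ht : S.Enabled t x) :
      Stage x₀ (3 * n + 1) (.inr t) (dat x 0)
  | snd {n x} (h : S.Reach x₀ (n + 1) x) : Stage x₀ (3 * n + 2) (.inl true) (dat 0 x)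

theorem Stage.exists_reach {S : AffineSystem m T} {x₀ : Fin m → ℝ} {k : ℕ} {v : Vertex T}
    {D : Fin m ⊕ Fin m → ℝ} (h : S.Stage x₀ k v D) : ∃ n x, k ≤ 3 * n + 1 ∧ S.Reach x₀ n x := by
  cases h with
  | @fst n x h => exact ⟨n, x, by omega, h⟩
  | @mid n x t h ht => exact ⟨n, x, by omega, h⟩
  | @snd n x h => exact ⟨n + 1, x, by omega, h⟩

variable [Fintype T] [DecidableEq T]

theorem sum_smul_rate_apply (e : Edge T) (lam : ℕ → ℝ) (s : Finset ℕ) (D : Fin m ⊕ Fin m → ℝ)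
    (i : Fin m ⊕ Fin m) :
    (D + ∑ j ∈ s, lam j • S.graph.rate e j) i = D i + ∑ j ∈ s, lam j * (S.rate e j i : ℝ) := by
  simp [graph]

/-- At the end of a map or copy edge, the zone pins the half being emptied to 0. As only mode `i`
changes its coordinate `i`, this gives `x i = K * lam i`, so the freedom in choosing durations has
no effect on the result. -/
theorem closed_stage (x₀ : Fin m → ℝ) : S.graph.Closed (S.Stage x₀) where
  step {k e D} lam h hlam hsum hsrc htgt := by
    set D' := D + ∑ j ∈ Finset.range S.graph.r, lam j • S.graph.rate e j with hD'
    have hval := S.sum_smul_rate_apply e lam (Finset.range S.graph.r) D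
    simp only [← hD'] at hval
    change ∑ j ∈ Finset.range (m + 1), lam j = 1 at hsum
    have hr : S.graph.r = m + 1 := rfl
    rw [hr] at hval
    have hd := (S.pt_mem_edgeZone.1 hsrc).2.2.2.2
    have hd' := (S.pt_mem_edgeZone.1 htgt).2.2.2.2
    clear hsrc htgt hr
    clear_value D'
    rcases e with _ | ⟨_ | _, t⟩
    · change S.Stage x₀ k (.inl true) D at h
      change S.Stage x₀ (k + 1) (.inl false) D'
      cases h with
      | @snd n x h =>
        have hlamx : ∀ i : Fin m, x i = S.K * lam i := by
          intro i
          have h1 := hd' i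
          rw [hval] at h1
          simp only [dat, rate, Sum.elim_inr, apply_ite (Rat.cast : ℚ → ℝ), Rat.cast_neg, Rat.cast_natCast,
            Rat.cast_zero, sum_mul_ite_eq, graph, tgt, atVertex] at h1
          rw [if_pos (by omega)] at h1
          simp at h1
          linarith [h1.1, h1.2]
        have : D' = dat x 0 := by
          funext i
          rw [hval]
          rcases i with i | i
          · simp only [dat, rate, Sum.elim_inl, apply_ite (Rat.cast : ℚ → ℝ), Rat.cast_natCast,
              Rat.cast_zero, sum_mul_ite_eq]
            rw [if_pos (by omega), hlamx]; simp [mul_comm]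
          · simp only [dat, rate, Sum.elim_inr, apply_ite (Rat.cast : ℚ → ℝ), Rat.cast_natCast, Rat.cast_neg,
              Rat.cast_zero, sum_mul_ite_eq]
            rw [if_pos (by omega), hlamx]; simp; ring
        rw [this]
        exact Stage.fst h
    · change S.Stage x₀ k (.inl false) D at h
      change S.Stage x₀ (k + 1) (.inr t) D'
      have : D' = D := by
        funext i
        rw [hval]; simp [rate]
      rw [this]
      cases h with
      | @fst n x h => exact Stage.mid h hd
    · change S.Stage x₀ k (.inr t) D at h
      change S.Stage x₀ (k + 1) (.inl true) D'
      cases h with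
      | @mid n x t h ht =>
        have hlamx : ∀ i : Fin m, x i = S.K * lam i := by
          intro i
          have h1 := hd' i
          rw [hval] at h1
          simp only [dat, rate, Sum.elim_inl, apply_ite (Rat.cast : ℚ → ℝ), Rat.cast_neg, Rat.cast_natCast,
            Rat.cast_zero, sum_mul_ite_eq, graph, tgt, atVertex] at h1
          rw [if_pos (by omega)] at h1
          simp at h1
          linarith [h1.1, h1.2]
        have : D' = dat 0 (S.apply t x) := by
          funext i
          rw [hval]
          rcases i with i | i
          · simp only [dat, rate, Sum.elim_inl, apply_ite (Rat.cast : ℚ → ℝ), Rat.cast_natCast, Rat.cast_neg,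
              Rat.cast_zero, sum_mul_ite_eq]
            rw [if_pos (by omega), hlamx]; simp; ring
          · have h2 := sum_mul_dite lam fun j => (S.K : ℝ) * S.F t i j
            simp only [dat, rate, Sum.elim_inr, Rat.cast_add, mul_add, Finset.sum_add_distrib,
              ← Finset.sum_mul, hsum, apply_dite (Rat.cast : ℚ → ℝ), Rat.cast_mul,
              Rat.cast_natCast, Rat.cast_zero, h2, apply]
            simp only [hlamx, Pi.zero_apply, zero_add, one_mul, add_comm (S.b t i : ℝ)]
            congr 1
            exact Finset.sum_congr rfl fun j _ => by ring
        rw [this]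
        exact Stage.snd (h.succ t ht)

theorem onPath_start (x : Fin m → ℚ) :
    S.graph.OnPath (S.Stage fun i => (x i : ℝ)) 0 (toReal (start (T := T) x)) := by
  rw [S.toReal_start]
  have := OnPath.vertex (G := S.graph) (Stage.fst (Reach.zero (S := S) (x₀ := fun i => (x i : ℝ))))
  simpa using this

/-- A step of the system takes three edges of one time unit each, so time beyond `3 * N + 3`,
available by non-Zenoness, requires at least `N` steps. -/
theorem exists_reach_of_answer_inputG [Nonempty T] {x : Fin m → ℚ} (h : (S.inputG x).Answer)
    (N : ℕ) : ∃ n ≥ N, ∃ y, S.Reach (fun i => (x i : ℝ)) n y := by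
  obtain ⟨π, hπ, hsat⟩ := h
  obtain ⟨n, hn⟩ := (hπ.eventually_ge_atTop (3 * N + 3 : ℝ)).exists
  set σ := π.induced (toReal (S.inputG x).start) with hσ
  have hT : σ.time n ∈ σ.dom :=
    Set.mem_iUnion.2 ⟨n, le_rfl, σ.time_strictMono.monotone n.le_succ⟩
  have hpath := onPath_val (G := S.graph) (S.closed_stage fun i => (x i : ℝ))
    (fun m hm => S.mem_mms.1 hm) π (S.onPath_start x) hT fun τ hτ _ => by
      obtain ⟨Z, hZ, hm⟩ := LTL.sat_orList.1 (hsat τ hτ (Schedule.nonneg_of_mem_dom hτ))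
      obtain ⟨e, rfl⟩ := S.mem_zones.1 hZ
      exact ⟨e, hm⟩
  replace hn : (3 * N + 3 : ℝ) ≤ σ.time n := hn
  obtain ⟨k, v, D, hs, hk⟩ := hpath.exists_vertex
  obtain ⟨n', y, hle, hr⟩ := hs.exists_reach
  refine ⟨n', ?_, y, hr⟩
  have h1 : (3 * N + 3 : ℝ) < k + 1 := hn.trans_lt hk
  have h2 : 3 * N + 3 < k + 1 := by exact_mod_cast h1
  omega

theorem exists_reach_of_answer_inputU [Nonempty T] {H : List (Ineq (Fin m))} {x : Fin m → ℚ}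
    (h : (S.inputU H x).Answer) :
    ∃ n y, S.Reach (fun i => (x i : ℝ)) n y ∧ ∀ c ∈ H, Ineq.Holds c y := by
  obtain ⟨π, -, T', hT, -, hfin, hsat⟩ := h
  have hpath := onPath_val (G := S.graph) (S.closed_stage fun i => (x i : ℝ))
    (fun m hm => S.mem_mms.1 hm) π (S.onPath_start x) hT fun τ hτ hlt => by
      obtain ⟨Z, hZ, hm⟩ := LTL.exists_mem_of_sat_untilList
        (hsat τ ⟨Schedule.nonneg_of_mem_dom hτ, hlt⟩)
      obtain ⟨e, rfl⟩ := S.mem_zones.1 hZ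
      exact ⟨e, hm⟩
  change (π.induced (toReal (S.inputU H x).start)).val T' ∈ (S.finalZone H).toSet at hfin
  change S.graph.OnPath _ T' ((π.induced (toReal (S.inputU H x).start)).val T') at hpath
  generalize (π.induced (toReal (S.inputU H x).start)).val T' = p at hfin hpath
  cases hpath with
  | @vertex k v D h =>
    obtain ⟨-, -, h1, h2⟩ := S.pt_mem_finalZone.1 hfin
    cases h with
    | @fst n x h => exact ⟨n, x, h, h2⟩
    | mid h ht => simp [atVertex] at h1; linarith
    | snd h => simp [atVertex] at h1; linarith
  -- Inside an edge every control coordinate is less than 1, which the final zone forbids.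
  | @edge k e D lam s h hr hlam hs h0 hlt =>
    obtain ⟨-, -, h1, h2⟩ := S.pt_mem_finalZone.1 hfin
    rcases e with _ | ⟨_ | _, t⟩ <;> simp [onEdge, graph, src, tgt] at h1 <;>
      linarith


/-! ### From runs of the affine system to executions -/

variable {m : ℕ} {T : Type} (S : AffineSystem m T)

/-- The points on which the system can be simulated. -/
def Small (x : Fin m → ℝ) : Prop := (∀ i, 0 < x i) ∧ ∑ i, x i < S.K

/-- The time for which each mode is used in order to move the point `x`. -/
noncomputable def share (x : Fin m → ℝ) (j : ℕ) : ℝ :=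
  if h : j < m then x ⟨j, h⟩ / S.K else 1 - (∑ i, x i) / S.K

variable {S}

theorem K_pos_real (S : AffineSystem m T) : (0 : ℝ) < S.K := by exact_mod_cast S.K_pos

theorem one_le_R (S : AffineSystem m T) : (1 : ℝ) ≤ S.R := by
  exact_mod_cast S.K_pos.trans_le S.K_le_R

theorem share_fin (x : Fin m → ℝ) (i : Fin m) : S.share x i = x i / S.K := by
  simp [share]

/-- Durations must be strictly positive, which is why `Small` asks for positive coordinates and a
sum strictly below `K`. -/
theorem share_pos {x : Fin m → ℝ} (hx : S.Small x) (j : ℕ) : 0 < S.share x j := by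
  have hK := S.K_pos_real
  unfold share
  split_ifs
  · exact div_pos (hx.1 _) hK
  · rw [sub_pos, div_lt_one hK]; exact hx.2

theorem sum_share (x : Fin m → ℝ) : ∑ j ∈ Finset.range (m + 1), S.share x j = 1 := by
  rw [Finset.sum_range_succ, Finset.sum_range]
  simp only [share_fin]
  rw [← Finset.sum_div]
  simp [share]

theorem sum_share_le_one {x : Fin m → ℝ} (hx : S.Small x) {j : ℕ} (hj : j ≤ m + 1) :
    ∑ i ∈ Finset.range j, S.share x i ≤ 1 := by
  rw [← sum_share (S := S) x]
  exact Finset.sum_le_sum_of_subset_of_nonneg (Finset.range_mono hj)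
    fun i _ _ => (share_pos hx i).le

theorem sum_share_nonneg {x : Fin m → ℝ} (hx : S.Small x) (j : ℕ) :
    0 ≤ ∑ i ∈ Finset.range j, S.share x i :=
  Finset.sum_nonneg fun i _ => (share_pos hx i).le

theorem share_le_one {x : Fin m → ℝ} (hx : S.Small x) {j : ℕ} (hj : j < m + 1) :
    S.share x j ≤ 1 := by
  rw [← sum_share (S := S) x]
  exact Finset.single_le_sum (fun i _ => (share_pos hx i).le) (Finset.mem_range.2 hj)

theorem le_of_small {x : Fin m → ℝ} (hx : S.Small x) (i : Fin m) : x i ≤ S.K :=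
  (Finset.single_le_sum (f := x) (fun i _ => (hx.1 i).le) (Finset.mem_univ i)).trans hx.2.le

theorem abs_le_of_small {x : Fin m → ℝ} (hx : S.Small x) (i : Fin m) : |x i| ≤ S.R := by
  rw [abs_of_pos (hx.1 i)]
  exact (le_of_small hx i).trans (by exact_mod_cast S.K_le_R)

theorem abs_dat_le {x y : Fin m → ℝ} (hx : ∀ i, |x i| ≤ S.R) (hy : ∀ i, |y i| ≤ S.R)
    (i : Fin m ⊕ Fin m) : |dat x y i| ≤ S.R := by
  rcases i with i | i
  exacts [hx i, hy i]

/-- What is left of `x` once it has been moved by the modes before `j`. -/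
theorem le_mul_sub_share {x : Fin m → ℝ} (hx : S.Small x) {j : ℕ} (i : Fin m) (hij : j ≤ i) :
    x i ≤ S.K * (1 - ∑ i ∈ Finset.range j, S.share x i) := by
  have hK := S.K_pos_real
  have h1 : ∑ i ∈ Finset.range (i + 1), S.share x i ≤ 1 := sum_share_le_one hx (by omega)
  have h2 : ∑ i ∈ Finset.range j, S.share x i ≤ ∑ i ∈ Finset.range i, S.share x i :=
    Finset.sum_le_sum_of_subset_of_nonneg (Finset.range_mono hij)
      fun i _ _ => (share_pos hx i).le
  rw [Finset.sum_range_succ, share_fin] at h1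
  have h3 : x i / S.K ≤ 1 - ∑ i ∈ Finset.range j, S.share x i := by linarith
  rw [div_le_iff₀ hK] at h3
  linarith

theorem sum_rate_transfer_inl (t : T) (x : Fin m → ℝ) (j : ℕ) (i : Fin m) :
    ∑ k ∈ Finset.range j, S.share x k * (S.rate (some (true, t)) k (.inl i) : ℝ) =
      if (i : ℕ) < j then - x i else 0 := by
  have hK := S.K_pos_real.ne'
  simp only [rate, Sum.elim_inl, apply_ite (Rat.cast : ℚ → ℝ), Rat.cast_neg, Rat.cast_natCast,
    Rat.cast_zero, sum_mul_ite_eq, share_fin]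
  split_ifs
  · field_simp
  · rfl

theorem sum_rate_copy_inl (x : Fin m → ℝ) (j : ℕ) (i : Fin m) :
    ∑ k ∈ Finset.range j, S.share x k * (S.rate none k (.inl i) : ℝ) =
      if (i : ℕ) < j then x i else 0 := by
  have hK := S.K_pos_real.ne'
  simp only [rate, Sum.elim_inl, apply_ite (Rat.cast : ℚ → ℝ), Rat.cast_natCast,
    Rat.cast_zero, sum_mul_ite_eq, share_fin]
  split_ifs
  · field_simp
  · rfl

theorem sum_rate_copy_inr (x : Fin m → ℝ) (j : ℕ) (i : Fin m) :
    ∑ k ∈ Finset.range j, S.share x k * (S.rate none k (.inr i) : ℝ) =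
      if (i : ℕ) < j then - x i else 0 := by
  have hK := S.K_pos_real.ne'
  simp only [rate, Sum.elim_inr, apply_ite (Rat.cast : ℚ → ℝ), Rat.cast_neg, Rat.cast_natCast,
    Rat.cast_zero, sum_mul_ite_eq, share_fin]
  split_ifs
  · field_simp
  · rfl

theorem sum_rate_transfer_inr (t : T) (x : Fin m → ℝ) (i : Fin m) :
    ∑ k ∈ Finset.range (m + 1), S.share x k * (S.rate (some (true, t)) k (.inr i) : ℝ) =
      S.apply t x i := by
  have hK := S.K_pos_real.ne'
  have h2 := sum_mul_dite (S.share x) fun j => (S.K : ℝ) * S.F t i j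
  simp only [rate, Sum.elim_inr, Rat.cast_add, mul_add, Finset.sum_add_distrib, ← Finset.sum_mul,
    sum_share, apply_dite (Rat.cast : ℚ → ℝ), Rat.cast_mul, Rat.cast_natCast, Rat.cast_zero, h2,
    apply, share_fin]
  rw [add_comm, one_mul]
  congr 1
  exact Finset.sum_congr rfl fun j _ => by field_simp

/-- The box must also contain the points where the image is only partly built. As every share is at
most 1 and all shares add up to 1, the bound on `F` and `b` covers these partial sums. -/
theorem abs_sum_rate_transfer_inr {x : Fin m → ℝ} (hx : S.Small x) (t : T) {j : ℕ}
    (hj : j ≤ m + 1) (i : Fin m) :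
    |∑ k ∈ Finset.range j, S.share x k * (S.rate (some (true, t)) k (.inr i) : ℝ)| ≤ S.R := by
  have hle : ∀ k, |S.share x k * (S.rate (some (true, t)) k (.inr i) : ℝ)| ≤
      S.share x k * |(S.b t i : ℝ)| +
        S.share x k * (if h : k < m then S.K * |(S.F t i ⟨k, h⟩ : ℝ)| else 0) := by
    intro k
    rw [abs_mul, abs_of_pos (share_pos hx k), ← mul_add]
    refine mul_le_mul_of_nonneg_left ?_ (share_pos hx k).le
    simp only [rate, Sum.elim_inr]
    split_ifs with h
    · push_cast
      refine (abs_add_le _ _).trans ?_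
      rw [abs_mul, Nat.abs_cast]
    · simp
  have hb : ∑ j, |(S.F t i j : ℝ)| * S.K + |(S.b t i : ℝ)| ≤ S.R := by exact_mod_cast S.bound t i
  refine (Finset.abs_sum_le_sum_abs _ _).trans ((Finset.sum_le_sum_of_subset_of_nonneg
    (Finset.range_mono hj) fun _ _ _ => abs_nonneg _).trans
    ((Finset.sum_le_sum fun k _ => hle k).trans (le_trans ?_ hb)))
  rw [Finset.sum_add_distrib, ← Finset.sum_mul, sum_share, one_mul,
    sum_mul_dite (S.share x) fun j => (S.K : ℝ) * |(S.F t i j : ℝ)|, add_comm]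
  refine add_le_add (Finset.sum_le_sum fun j _ => ?_) le_rfl
  have h0 : 0 ≤ (S.K : ℝ) * |(S.F t i j : ℝ)| := by positivity
  calc S.share x j * (S.K * |(S.F t i j : ℝ)|) ≤ 1 * (S.K * |(S.F t i j : ℝ)|) :=
        mul_le_mul_of_nonneg_right (share_le_one hx (by omega)) h0
    _ = _ := by ring

variable [Fintype T] [DecidableEq T]

theorem pt_onEdge_mem_edgeZone {e : Edge T} {s : ℝ} (h0 : 0 ≤ s) (h1 : s ≤ 1)
    {D : Fin m ⊕ Fin m → ℝ} (hD : ∀ i, |D i| ≤ S.R) (hd : S.DataCond e (S.graph.onEdge e s) D) :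
    S.graph.pt (S.graph.onEdge e s) D ∈ (S.edgeZone e).toSet := by
  have h2 : ∀ v, 0 ≤ S.graph.onEdge e s v ∧ S.graph.onEdge e s v ≤ 1 := by
    intro v
    by_cases hs : v = S.graph.src e
    · subst hs; rw [onEdge_src]; constructor <;> linarith
    · by_cases ht : v = S.graph.tgt e
      · subst ht; rw [onEdge_tgt]; exact ⟨h0, h1⟩
      · rw [onEdge_of_ne _ _ _ hs ht]; exact ⟨le_rfl, zero_le_one⟩
  refine S.pt_mem_edgeZone.2 ⟨fun v => ?_, hD, fun v => (h2 v).1, fun v hs ht => ?_, hd⟩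
  · rw [abs_of_nonneg (h2 v).1]; exact (h2 v).2.trans S.one_le_R
  · exact (S.graph.onEdge_of_ne e s hs ht).le

theorem guard_mem {x : Fin m → ℝ} (hx : S.Small x) {t : T} (ht : S.Enabled t x) {j : ℕ}
    (hj : j ≤ m + 1) :
    S.graph.pt (S.graph.onEdge (some (false, t)) (∑ i ∈ Finset.range j, S.share x i))
      (dat x 0 + ∑ i ∈ Finset.range j, S.share x i • S.graph.rate (some (false, t)) i) ∈
      (S.edgeZone (some (false, t))).toSet := by
  have hD : dat x 0 + ∑ i ∈ Finset.range j, S.share x i • S.graph.rate (some (false, t)) i =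
      dat x 0 := by
    funext i; rw [sum_smul_rate_apply]; simp [rate]
  rw [hD]
  exact pt_onEdge_mem_edgeZone (sum_share_nonneg hx j) (sum_share_le_one hx hj)
    (abs_dat_le (abs_le_of_small hx) (by simp)) ht

/-- Before mode `j`, the coordinates below `j` are already 0 and the others are untouched; the
latter respect the upper bound since the time needed to drain them is part of the time that remains.
-/
theorem transfer_mem {x : Fin m → ℝ} (hx : S.Small x) (t : T) {j : ℕ} (hj : j ≤ m + 1) :
    S.graph.pt (S.graph.onEdge (some (true, t)) (∑ i ∈ Finset.range j, S.share x i))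
      (dat x 0 + ∑ i ∈ Finset.range j, S.share x i • S.graph.rate (some (true, t)) i) ∈
      (S.edgeZone (some (true, t))).toSet := by
  have hl : ∀ i, (dat x 0 + ∑ i ∈ Finset.range j,
      S.share x i • S.graph.rate (some (true, t)) i) (.inl i) =
      if (i : ℕ) < j then 0 else x i := by
    intro i
    rw [sum_smul_rate_apply, sum_rate_transfer_inl]
    split_ifs <;> simp [dat]
  have hc : S.graph.onEdge (some (true, t)) (∑ i ∈ Finset.range j, S.share x i) (.inr t) =
      1 - ∑ i ∈ Finset.range j, S.share x i := S.graph.onEdge_src (some (true, t)) _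
  refine pt_onEdge_mem_edgeZone (sum_share_nonneg hx j) (sum_share_le_one hx hj) ?_ fun i => ?_
  · rintro (i | i)
    · rw [hl]
      split_ifs
      · simp
      · exact abs_le_of_small hx i
    · rw [sum_smul_rate_apply]
      simpa [dat] using abs_sum_rate_transfer_inr hx t hj i
  · rw [hl, hc]
    split_ifs with h
    · exact ⟨le_rfl, mul_nonneg S.K_pos_real.le (sub_nonneg.2 (sum_share_le_one hx hj))⟩
    · exact ⟨(hx.1 i).le, le_mul_sub_share hx i (not_lt.1 h)⟩

theorem copy_mem {x : Fin m → ℝ} (hx : S.Small x) {j : ℕ} (hj : j ≤ m + 1) :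
    S.graph.pt (S.graph.onEdge none (∑ i ∈ Finset.range j, S.share x i))
      (dat 0 x + ∑ i ∈ Finset.range j, S.share x i • S.graph.rate none i) ∈
      (S.edgeZone none).toSet := by
  have hl : ∀ i, (dat 0 x + ∑ i ∈ Finset.range j, S.share x i • S.graph.rate none i) (.inr i) =
      if (i : ℕ) < j then 0 else x i := by
    intro i
    rw [sum_smul_rate_apply, sum_rate_copy_inr]
    split_ifs <;> simp [dat]
  have hc : S.graph.onEdge none (∑ i ∈ Finset.range j, S.share x i) (.inl true) =
      1 - ∑ i ∈ Finset.range j, S.share x i := S.graph.onEdge_src none _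
  refine pt_onEdge_mem_edgeZone (sum_share_nonneg hx j) (sum_share_le_one hx hj) ?_ fun i => ?_
  · rintro (i | i)
    · rw [sum_smul_rate_apply, sum_rate_copy_inl]
      split_ifs
      · simpa [dat] using abs_le_of_small hx i
      · simp [dat]
    · rw [hl]
      split_ifs
      · simp
      · exact abs_le_of_small hx i
  · rw [hl, hc]
    split_ifs with h
    · exact ⟨le_rfl, mul_nonneg S.K_pos_real.le (sub_nonneg.2 (sum_share_le_one hx hj))⟩
    · exact ⟨(hx.1 i).le, le_mul_sub_share hx i (not_lt.1 h)⟩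

/-- The sequence `a 0, b 0, c 0, a 1, b 1, c 1, …`. -/
def interleave {α : Type*} (a b c : ℕ → α) (k : ℕ) : α :=
  if k % 3 = 0 then a (k / 3) else if k % 3 = 1 then b (k / 3) else c (k / 3)

section

variable {α : Type*} (a b c : ℕ → α) (n : ℕ)

@[simp] theorem interleave_zero : interleave a b c (3 * n) = a n := by
  simp [interleave]

@[simp] theorem interleave_one : interleave a b c (3 * n + 1) = b n := by
  have h1 : (3 * n + 1) % 3 = 1 := by omega
  have h2 : (3 * n + 1) / 3 = n := by omega
  simp [interleave, h1, h2]

@[simp] theorem interleave_two : interleave a b c (3 * n + 2) = c n := by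
  have h1 : (3 * n + 2) % 3 = 2 := by omega
  have h2 : (3 * n + 2) / 3 = n := by omega
  simp [interleave, h1, h2]

end

theorem exists_eq_three_mul (k : ℕ) : ∃ n, k = 3 * n ∨ k = 3 * n + 1 ∨ k = 3 * n + 2 :=
  ⟨k / 3, by omega⟩

/-- The edges that simulate the maps `t 0, t 1, …`. -/
def runEdge (t : ℕ → T) : ℕ → Edge T :=
  interleave (fun n => some (false, t n)) (fun n => some (true, t n)) fun _ => none

open Classical in
/-- The simulation of a run of the system, up to any time until which it is indeed a run. -/
theorem exists_schedule {u : ℕ → Fin m → ℝ} (t : ℕ → T) (hu : ∀ n, S.Small (u n)) :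
    ∃ π : Schedule (S.modes.map toReal).toFinset, π.NonZeno ∧
      ∀ σ, σ = π.induced (S.graph.pt (atVertex (.inl false)) (dat (u 0) 0)) →
      (∀ τ, 0 ≤ τ → τ ∈ σ.dom) ∧
      ∀ N, (∀ n < N, S.Enabled (t n) (u n) ∧ u (n + 1) = S.apply (t n) (u n)) →
        (∀ k < 3 * N, ∀ τ ∈ Set.Icc (k : ℝ) (k + 1), σ.val τ ∈ (S.edgeZone (runEdge t k)).toSet) ∧
        σ.val ((3 * N : ℕ) : ℝ) = S.graph.pt (atVertex (.inl false)) (dat (u N) 0) := by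
  let edge : ℕ → Edge T := runEdge t
  -- On guard edges the data stand still, so any positive shares would do; copy edges move the new
  -- point `u (n + 1)`.
  let lam : ℕ → ℕ → ℝ := interleave (fun n => S.share (u n)) (fun n => S.share (u n))
    fun n => S.share (u (n + 1))
  let D : ℕ → Fin m ⊕ Fin m → ℝ := interleave (fun n => dat (u n) 0) (fun n => dat (u n) 0)
    fun n => dat 0 (u (n + 1))
  have hM : ∀ e, ∀ j < S.graph.r, S.graph.mode e j ∈ (S.modes.map toReal).toFinset :=
    fun e j hj => S.mem_mms.2 ⟨e, j, hj, rfl⟩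
  have hr : 0 < S.graph.r := Nat.succ_pos m
  have hlam : ∀ k, ∀ j < S.graph.r, 0 < lam k j := by
    intro k j _
    obtain ⟨n, rfl | rfl | rfl⟩ := exists_eq_three_mul k
    · simpa [lam] using share_pos (hu n) j
    · simpa [lam] using share_pos (hu n) j
    · simpa [lam] using share_pos (hu (n + 1)) j
  have hsum : ∀ k, ∑ j ∈ Finset.range S.graph.r, lam k j = 1 := by
    intro k
    change ∑ j ∈ Finset.range (m + 1), lam k j = 1
    obtain ⟨n, rfl | rfl | rfl⟩ := exists_eq_three_mul k <;> simp [lam, sum_share]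
  have hedge : ∀ k, S.graph.tgt (edge k) = S.graph.src (edge (k + 1)) := by
    intro k
    obtain ⟨n, rfl | rfl | rfl⟩ := exists_eq_three_mul k
    · simp [edge, runEdge, graph, src, tgt]
    · simp [edge, runEdge, graph, src, tgt]
    · rw [show 3 * n + 2 + 1 = 3 * (n + 1) by ring]
      simp [edge, runEdge, graph, src, tgt]
  have hx : S.graph.pt (atVertex (.inl false)) (dat (u 0) 0) =
      S.graph.pt (atVertex (S.graph.src (edge 0))) (D 0) := by
    simp [edge, runEdge, D, interleave, graph, src]
  refine ⟨pathSchedule hM hr edge lam hlam, pathSchedule_nonZeno hM hr hlam hsum, ?_⟩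
  rintro σ rfl
  refine ⟨fun τ => pathSchedule_mem_dom hM hr hlam hsum _, fun N hN => ?_⟩
  rw [hx]
  have hD : ∀ k < 3 * N, D (k + 1) =
      D k + ∑ j ∈ Finset.range S.graph.r, lam k j • S.graph.rate (edge k) j := by
    intro k hk
    funext i
    rw [sum_smul_rate_apply]
    change _ = _ + ∑ j ∈ Finset.range (m + 1), _
    obtain ⟨n, rfl | rfl | rfl⟩ := exists_eq_three_mul k
    · simp [D, lam, edge, runEdge, rate]
    · obtain ⟨-, h2⟩ := hN n (by omega)
      simp only [D, lam, edge, runEdge, interleave_one, interleave_two, add_assoc,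
        Nat.reduceAdd]
      rcases i with i | i
      · rw [sum_rate_transfer_inl, if_pos (by omega)]; simp [dat]
      · rw [sum_rate_transfer_inr]; simp [dat, h2]
    · rw [show 3 * n + 2 + 1 = 3 * (n + 1) by ring]
      simp only [D, lam, edge, runEdge, interleave_zero, interleave_two]
      rcases i with i | i
      · rw [sum_rate_copy_inl, if_pos (by omega)]; simp [dat]
      · rw [sum_rate_copy_inr, if_pos (by omega)]; simp [dat]
  refine ⟨fun k hk τ hτ => ?_, ?_⟩
  · refine pathSchedule_mem_region hM hr hlam hsum hedge hD hk (fun j hj => ?_) hτ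
    change j ≤ m + 1 at hj
    change _ ∈ (S.edgeZone (edge k)).toSet
    obtain ⟨n, rfl | rfl | rfl⟩ := exists_eq_three_mul k
    · simp only [D, lam, edge, runEdge, interleave_zero]
      exact guard_mem (hu n) (hN n (by omega)).1 hj
    · simp only [D, lam, edge, runEdge, interleave_one]
      exact transfer_mem (hu n) (t n) hj
    · simp only [D, lam, edge, runEdge, interleave_two]
      exact copy_mem (hu (n + 1)) hj
  · rw [pathSchedule_val_nat hM hr hlam hsum hedge hD le_rfl]
    simp [edge, runEdge, D, graph, src]

theorem sat_untilList {σ : Execution (Fintype.card (Coord m T))} (t : ℕ → T) {N : ℕ}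
    (hdom : ∀ τ, 0 ≤ τ → τ ∈ σ.dom)
    (h : ∀ k < 3 * N, ∀ τ ∈ Set.Icc (k : ℝ) (k + 1),
      σ.val τ ∈ (S.edgeZone (runEdge t k)).toSet) {τ : ℝ} (h0 : 0 ≤ τ) (hτ : τ < (3 * N : ℕ)) :
    LTL.Sat σ (LTL.untilList (S.edgeZone none) S.stepZones) τ := by
  have hfl : τ ∈ Set.Ico (⌊τ⌋₊ : ℝ) (⌊τ⌋₊ + 1) := ⟨Nat.floor_le h0, Nat.lt_floor_add_one τ⟩
  have hlt : ⌊τ⌋₊ < 3 * N := by exact_mod_cast hfl.1.trans_lt hτ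
  have hmem : ∀ s : T, ∃ l₁ l₂, Finset.univ.toList = l₁ ++ s :: l₂ :=
    fun s => List.append_of_mem (Finset.mem_toList.2 (Finset.mem_univ s))
  obtain ⟨n, hn⟩ := exists_eq_three_mul ⌊τ⌋₊
  have hnN : n < N := by omega
  -- The copy zone is the innermost operand, so once it is entered every until in front of it may be
  -- fulfilled at once.
  have hcopy : ∀ l, LTL.Sat σ (LTL.untilList (S.edgeZone none) l) (3 * n + 2 : ℕ) := by
    refine fun l => LTL.sat_untilList_of_zone l (hdom _ (Nat.cast_nonneg _)) ?_
    have := h (3 * n + 2) (by omega) (3 * n + 2 : ℕ) (by simp)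
    simpa [runEdge] using this
  have htrans : ∀ τ : ℝ, 0 ≤ τ → ((3 * n + 1 : ℕ) : ℝ) ≤ τ → τ ≤ ((3 * n + 2 : ℕ) : ℝ) → ∀ l,
      LTL.Sat σ (LTL.untilList (S.edgeZone none) (l ++
        Finset.univ.toList.map fun t => S.edgeZone (some (true, t)))) τ := by
    intro τ h0 h1 h2 l
    obtain ⟨l₁, l₂, hl⟩ := hmem (t n)
    rw [hl, List.map_append, List.map_cons, ← List.append_assoc]
    refine LTL.sat_untilList_append _ (hdom τ h0) (LTL.sat_untilList_of_mem
      (hdom _ (Nat.cast_nonneg (3 * n + 2))) h2 (fun τ'' hτ'' => ?_) (hcopy _))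
    have := h (3 * n + 1) (by omega) τ''
      ⟨h1.trans hτ''.1, hτ''.2.le.trans (by push_cast; linarith)⟩
    simpa [runEdge] using this
  rcases hn with hn | hn | hn <;> rw [hn] at hfl
  · obtain ⟨l₁, l₂, hl⟩ := hmem (t n)
    have h1 := htrans (3 * n + 1 : ℕ) (Nat.cast_nonneg _) le_rfl (by push_cast; linarith)
      (l₂.map fun t => S.edgeZone (some (false, t)))
    have h2 : S.stepZones = l₁.map (fun t => S.edgeZone (some (false, t))) ++
        -- All map zones come after all guard zones, so whichever map is used, its zone is still
        -- available after its guard.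
        (S.edgeZone (some (false, t n)) :: (l₂.map (fun t => S.edgeZone (some (false, t))) ++
          Finset.univ.toList.map fun t => S.edgeZone (some (true, t)))) := by
      rw [stepZones]
      nth_rewrite 1 [hl]
      simp
    rw [h2]
    refine LTL.sat_untilList_append _ (hdom τ h0) (LTL.sat_untilList_of_mem
      (hdom _ (Nat.cast_nonneg (3 * n + 1))) (by push_cast; exact_mod_cast hfl.2.le)
      (fun τ'' hτ'' => ?_) h1)
    have := h (3 * n) (by omega) τ''
      ⟨hfl.1.trans hτ''.1, hτ''.2.le.trans (by push_cast; linarith)⟩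
    simpa [runEdge] using this
  · exact htrans τ h0 hfl.1 (hfl.2.le.trans (by push_cast; linarith)) _
  · refine LTL.sat_untilList_of_zone _ (hdom τ h0) ?_
    have := h (3 * n + 2) (by omega) τ ⟨hfl.1, hfl.2.le⟩
    simpa [runEdge] using this

variable [Nonempty T]

theorem answer_inputG {x : Fin m → ℚ} {u : ℕ → Fin m → ℝ} (h0 : u 0 = fun i => (x i : ℝ))
    (t : ℕ → T) (hu : ∀ n, S.Small (u n))
    (hstep : ∀ n, S.Enabled (t n) (u n) ∧ u (n + 1) = S.apply (t n) (u n)) :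
    (S.inputG x).Answer := by
  obtain ⟨π, hπ, h⟩ := exists_schedule t hu
  refine ⟨π, hπ, fun τ _ hτ => LTL.sat_orList.2 ?_⟩
  change ∃ Z ∈ _, (π.induced (toReal (start x))).val τ ∈ _
  rw [S.toReal_start, ← h0]
  obtain ⟨h1, -⟩ := (h _ rfl).2 (⌊τ⌋₊ + 1) fun n _ => hstep n
  exact ⟨_, S.mem_zones.2 ⟨_, rfl⟩, h1 ⌊τ⌋₊ (by omega) τ
    ⟨Nat.floor_le hτ, (Nat.lt_floor_add_one τ).le⟩⟩

theorem answer_inputU {H : List (Ineq (Fin m))} {x : Fin m → ℚ} {u : ℕ → Fin m → ℝ}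
    (h0 : u 0 = fun i => (x i : ℝ)) (t : ℕ → T) (hu : ∀ n, S.Small (u n)) {N : ℕ}
    (hstep : ∀ n < N, S.Enabled (t n) (u n) ∧ u (n + 1) = S.apply (t n) (u n))
    (hH : ∀ c ∈ H, Ineq.Holds c (u N)) : (S.inputU H x).Answer := by
  obtain ⟨π, hπ, h⟩ := exists_schedule t hu
  obtain ⟨hdom, h2⟩ := h _ rfl
  obtain ⟨h3, h4⟩ := h2 N hstep
  have hstart : (π.induced (toReal (start (T := T) x))) =
      π.induced (S.graph.pt (atVertex (.inl false)) (dat (u 0) 0)) := by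
    rw [S.toReal_start, ← h0]
  refine ⟨π, hπ, ?_⟩
  change LTL.Sat (π.induced (toReal (start (T := T) x))) _ 0
  rw [hstart]
  refine ⟨(3 * N : ℕ), hdom _ (Nat.cast_nonneg _), Nat.cast_nonneg _, ?_, fun τ hτ =>
    sat_untilList t hdom h3 hτ.1 hτ.2⟩
  change _ ∈ (S.finalZone H).toSet
  rw [h4]
  have hR := S.one_le_R
  refine S.pt_mem_finalZone.2 ⟨fun v => ?_,
    abs_dat_le (abs_le_of_small (hu N)) (by simp), by simp [atVertex], hH⟩
  simp only [atVertex, Pi.single_apply]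
  split_ifs <;> simp [hR]

end AffineSystem

/-! ### Diagonal systems, and tapes as numbers -/

/-- An affine system given by diagonal maps. -/
def AffineSystem.ofDiagonal {m : ℕ} {T : Type} [Fintype T] (guard : T → List (Ineq (Fin m)))
    (f b : T → Fin m → ℚ) (K : ℕ) (hK : 0 < K) : AffineSystem m T where
  guard := guard
  F t i j := if i = j then f t i else 0
  b := b
  K := K
  R := K + ∑ t, ∑ i, ⌈|f t i| * K + |b t i|⌉₊
  K_pos := hK
  K_le_R := Nat.le_add_right _ _
  bound t i := by
    have h1 : ∑ j, |if i = j then f t i else 0| * (K : ℚ) = |f t i| * K := by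
      simp [apply_ite abs, ite_mul]
    have h2 : ⌈|f t i| * (K : ℚ) + |b t i|⌉₊ ≤ ∑ t, ∑ i, ⌈|f t i| * (K : ℚ) + |b t i|⌉₊ :=
      (Finset.single_le_sum (f := fun i => ⌈|f t i| * (K : ℚ) + |b t i|⌉₊)
        (fun _ _ => Nat.zero_le _) (Finset.mem_univ i)).trans
        (Finset.single_le_sum (f := fun t => ∑ i, ⌈|f t i| * (K : ℚ) + |b t i|⌉₊)
        (fun _ _ => Nat.zero_le _) (Finset.mem_univ t))
    rw [h1]
    refine (Nat.le_ceil _).trans ?_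
    exact_mod_cast h2.trans (Nat.le_add_left _ _)

theorem AffineSystem.apply_ofDiagonal {m : ℕ} {T : Type} [Fintype T]
    {guard : T → List (Ineq (Fin m))} {f b : T → Fin m → ℚ} {K : ℕ} {hK : 0 < K} (t : T)
    (x : Fin m → ℝ) (i : Fin m) :
    (AffineSystem.ofDiagonal guard f b K hK).apply t x i = f t i * x i + b t i := by
  simp [AffineSystem.apply, AffineSystem.ofDiagonal, apply_ite (Rat.cast : ℚ → ℝ), ite_mul]

/-- The base in which tapes are written. -/
def tapeBase (Γ : Type) [Fintype Γ] : ℕ := 2 * Fintype.card Γ + 3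

theorem tapeBase_pos {Γ : Type} [Fintype Γ] : (0 : ℚ) < tapeBase Γ := by
  simp only [tapeBase]; positivity

section Tape

variable {Γ : Type} [Inhabited Γ] [Fintype Γ] [DecidableEq Γ] (s : Γ)

/-- The digit of a symbol: distinct even numbers, the least for `s` and the greatest for the
blank. -/
noncomputable def digit (a : Γ) : ℕ :=
  -- The blank has digit `tapeBase Γ - 1`, so blank half-tapes have the positive value 1; digit 0
  -- for `s` gives `sⁿ` the value `tapeBase Γ ^ (-n)`. Evenness leaves gaps, so closed conditions
  -- can separate digits.
  if a = s then 0 else if a = default then 2 * (Fintype.card Γ + 1)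
  else 2 * ((Fintype.equivFin Γ a : ℕ) + 1)

/-- The number that represents a half-tape with finitely many nonblank symbols. -/
noncomputable def listValue (l : List Γ) : ℚ :=
  l.foldr (fun a x => (digit s a + x) / tapeBase Γ) 1

variable {s}

theorem two_dvd_digit (a : Γ) : 2 ∣ digit s a := by
  unfold digit; split_ifs <;> simp

theorem digit_injective : Function.Injective (digit s) := by
  intro a b h
  have ha := (Fintype.equivFin Γ a).isLt
  have hb := (Fintype.equivFin Γ b).isLt
  unfold digit at h
  split_ifs at h with h1 h2 h3 h4 h5 h6 h7 h8
  all_goals first | omega | (subst_vars; rfl) | skip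
  exact (Fintype.equivFin Γ).injective (Fin.ext (by omega))

theorem digit_lt (a : Γ) : digit s a < tapeBase Γ := by
  have ha := (Fintype.equivFin Γ a).isLt
  unfold digit tapeBase; split_ifs <;> omega

theorem digit_default (hs : s ≠ default) : digit s (default : Γ) + 1 = tapeBase Γ := by
  simp [digit, hs.symm, tapeBase]; ring

theorem listValue_cons (a : Γ) (l : List Γ) :
    listValue s (a :: l) = (digit s a + listValue s l) / tapeBase Γ := rfl

theorem listValue_pos (l : List Γ) : 0 < listValue s l := by
  induction l with
  | nil => exact one_pos
  | cons a l ih =>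
    rw [listValue_cons]
    exact div_pos (by positivity) tapeBase_pos

theorem listValue_le_one (l : List Γ) : listValue s l ≤ 1 := by
  induction l with
  | nil => exact le_rfl
  | cons a l ih =>
    rw [listValue_cons, div_le_one tapeBase_pos]
    have : (digit s a + 1 : ℚ) ≤ tapeBase Γ := by exact_mod_cast digit_lt a
    linarith

/-- Prepending a blank fixes the value 1 of the empty list. This makes the value well defined on
half-tapes. -/
theorem listValue_append_blank (hs : s ≠ default) (l : List Γ) (n : ℕ) :
    listValue s (l ++ List.replicate n default) = listValue s l := by
  have h : ∀ n, listValue s (List.replicate n default) = 1 := by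
    intro n
    induction n with
    | zero => rfl
    | succ n ih =>
      rw [List.replicate_succ, listValue_cons, ih, div_eq_one_iff_eq tapeBase_pos.ne']
      exact_mod_cast digit_default hs
  induction l with
  | nil => rw [List.nil_append, h]; rfl
  | cons a l ih => rw [List.cons_append, listValue_cons, listValue_cons, ih]

theorem listValue_replicate (n : ℕ) :
    listValue s (List.replicate n s) = ((tapeBase Γ ^ n : ℕ) : ℚ)⁻¹ := by
  have h := (tapeBase_pos (Γ := Γ)).ne'
  induction n with
  | zero => simp [listValue]
  | succ n ih =>
    rw [List.replicate_succ, listValue_cons, ih]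
    simp only [digit, if_true]
    push_cast
    rw [pow_succ]
    field_simp
    ring

/-- The number that represents a half-tape. -/
noncomputable def tapeValue (hs : s ≠ default) (L : ListBlank Γ) : ℚ :=
  L.liftOn (listValue s) fun a b h => by
    obtain ⟨n, rfl⟩ := h
    exact (listValue_append_blank hs a n).symm

variable (hs : s ≠ default)

theorem tapeValue_mk (l : List Γ) : tapeValue hs (ListBlank.mk l) = listValue s l := rfl

theorem tapeValue_cons (a : Γ) (L : ListBlank Γ) :
    tapeValue hs (L.cons a) = (digit s a + tapeValue hs L) / tapeBase Γ := by
  induction L using ListBlank.induction_on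
  rw [ListBlank.cons_mk, tapeValue_mk, tapeValue_mk, listValue_cons]

theorem tapeValue_eq (L : ListBlank Γ) :
    tapeValue hs L = (digit s L.head + tapeValue hs L.tail) / tapeBase Γ := by
  rw [← tapeValue_cons, ListBlank.cons_head_tail]

theorem tapeValue_pos (L : ListBlank Γ) : 0 < tapeValue hs L := by
  induction L using ListBlank.induction_on
  exact listValue_pos _

theorem tapeValue_le_one (L : ListBlank Γ) : tapeValue hs L ≤ 1 := by
  induction L using ListBlank.induction_on
  exact listValue_le_one _

/-- The first symbol of a half-tape can be read off from its value. -/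
theorem digit_le_iff (L : ListBlank Γ) (b : Γ) :
    ((digit s b : ℚ) ≤ tapeBase Γ * tapeValue hs L ∧
      tapeBase Γ * tapeValue hs L ≤ digit s b + 1) ↔ L.head = b := by
  rw [tapeValue_eq, mul_div_cancel₀ _ tapeBase_pos.ne']
  have h0 := tapeValue_pos hs L.tail
  have h1 := tapeValue_le_one hs L.tail
  constructor
  -- The tail lies in (0, 1], so the inequalities leave two candidates for the first digit that
  -- differ by 1; parity excludes one.
  · rintro ⟨h2, h3⟩
    have h4 : (digit s b : ℚ) ≤ digit s L.head + 1 := by linarith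
    have h5 : (digit s L.head : ℚ) < digit s b + 1 := by linarith
    have h6 : digit s b ≤ digit s L.head + 1 := by exact_mod_cast h4
    have h7 : digit s L.head < digit s b + 1 := by exact_mod_cast h5
    have h8 := two_dvd_digit (s := s) b
    have h9 := two_dvd_digit (s := s) L.head
    exact digit_injective (s := s) (by omega)
  · rintro rfl
    constructor <;> linarith

end Tape


/-! ### Turing machines as affine systems -/

/-- The inequalities that say that the first digit of `xᵢ` is `n`. -/
def digitIneqs {m : ℕ} (i : Fin m) (B n : ℕ) : List (Ineq (Fin m)) :=
  [(Pi.single i (B : ℤ), (n : ℤ) + 1), (Pi.single i (-(B : ℤ)), -(n : ℤ))]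

theorem holds_digitIneqs {m : ℕ} {i : Fin m} {B n : ℕ} {x : Fin m → ℝ} :
    (∀ c ∈ digitIneqs i B n, Ineq.Holds c x) ↔ (n : ℝ) ≤ B * x i ∧ B * x i ≤ n + 1 := by
  simp [digitIneqs, Ineq.Holds, Ineq.sum_single, and_comm]

namespace TM

variable {Γ Λ : Type} [Fintype Γ] [Inhabited Λ] (M : TM0.Machine Γ Λ) (S : Finset Λ)

open Classical in
/-- The number of a state and a symbol under the head, the same for all that halt. -/
noncomputable def pc (q : Λ) (a : Γ) : ℕ :=
  if h : q ∈ S ∧ (M q a).isSome then (Fintype.equivFin (S × Γ) (⟨q, h.1⟩, a) : ℕ) + 1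
  else Fintype.card (S × Γ) + 1

theorem pc_pos (q : Λ) (a : Γ) : 0 < pc M S q a := by
  unfold pc; split_ifs <;> simp

theorem pc_le (q : Λ) (a : Γ) : pc M S q a ≤ Fintype.card (S × Γ) + 1 := by
  unfold pc
  split_ifs with h
  · have := (Fintype.equivFin (S × Γ) (⟨q, h.1⟩, a)).isLt
    omega
  · exact le_rfl

variable {M S}

/-- Halting pairs share a number above all others, so one linear inequality detects halting. -/
theorem card_lt_pc_iff {q : Λ} (hq : q ∈ S) {a : Γ} :
    Fintype.card (S × Γ) + 1 ≤ pc M S q a ↔ M q a = none := by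
  unfold pc
  split_ifs with h
  · have := (Fintype.equivFin (S × Γ) (⟨q, h.1⟩, a)).isLt
    rw [← Option.not_isSome_iff_eq_none]
    simp only [h.2, not_true_eq_false, iff_false]
    omega
  · simpa [hq] using h

theorem pc_inj {q q' : Λ} {a a' : Γ} (hq : q ∈ S) (ha : (M q a).isSome)
    (h : pc M S q' a' = pc M S q a) : q' = q ∧ a' = a := by
  have h1 : q ∈ S ∧ (M q a).isSome := ⟨hq, ha⟩
  have h0 := (Fintype.equivFin (S × Γ) (⟨q, h1.1⟩, a)).isLt
  unfold pc at h
  rw [dif_pos h1] at h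
  split_ifs at h with h2
  · have h3 := (Fintype.equivFin (S × Γ)).injective (Fin.ext (Nat.succ_injective h))
    simpa using h3
  · omega

variable [Inhabited Γ] [DecidableEq Γ] (M S) (s : Γ)

/-- The type of the transitions: state, symbol under the head, and neighbouring symbol. -/
abbrev Trans (Γ : Type) {Λ : Type} (S : Finset Λ) := S × Γ × Γ

/-- The condition under which a transition is made. -/
noncomputable def guard (t : Trans Γ S) : List (Ineq (Fin 3)) :=
  match M t.1 t.2.1 with
  -- The inequality `0 ≤ -1`: no transition from a halting pair.
  | none => [(0, -1)]
  | some (_, st) => [Ineq.le 0 (pc M S t.1 t.2.1), Ineq.ge 0 (pc M S t.1 t.2.1)] ++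
    match st with
    | .move .left => digitIneqs 1 (tapeBase Γ) (digit s t.2.2)
    | .move .right => digitIneqs 2 (tapeBase Γ) (digit s t.2.2)
    | .write _ => []

/-- The linear part of a transition. -/
noncomputable def scale (t : Trans Γ S) : Fin 3 → ℚ :=
  match M t.1 t.2.1 with
  | none => 0
  -- Together with `shift`, this pops the neighbouring symbol off the left half and pushes the
  -- scanned one onto the right half. The first coordinate is overwritten, as the transition already
  -- knows the next state and symbol.
  | some (_, .move .left) => ![0, tapeBase Γ, 1 / tapeBase Γ]
  | some (_, .move .right) => ![0, 1 / tapeBase Γ, tapeBase Γ]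
  | some (_, .write _) => ![0, 1, 1]

/-- The constant part of a transition. -/
noncomputable def shift (t : Trans Γ S) : Fin 3 → ℚ :=
  match M t.1 t.2.1 with
  | none => 0
  | some (q, .move .left) => ![pc M S q t.2.2, -digit s t.2.2, digit s t.2.1 / tapeBase Γ]
  | some (q, .move .right) => ![pc M S q t.2.2, digit s t.2.1 / tapeBase Γ, -digit s t.2.2]
  | some (q, .write c) => ![pc M S q c, 0, 0]

/-- The affine system that simulates a Turing machine. -/
noncomputable def system : AffineSystem 3 (Trans Γ S) :=
  -- The first coordinate is at most `card + 1` and the half-tapes at most 1 each, so the sum stays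
  -- strictly below `card + 4`.
  .ofDiagonal (guard M S s) (scale M S) (shift M S s) (Fintype.card (S × Γ) + 4) (Nat.succ_pos _)

variable {s} (hs : s ≠ default)

/-- The point that represents a configuration. -/
noncomputable def enc (c : TM0.Cfg Γ Λ) : Fin 3 → ℚ :=
  ![pc M S c.q c.Tape.head, tapeValue hs c.Tape.left, tapeValue hs c.Tape.right]

/-- The point that represents a configuration. -/
noncomputable def encR (c : TM0.Cfg Γ Λ) : Fin 3 → ℝ := fun i => (enc M S hs c i : ℝ)

theorem small_encR (c : TM0.Cfg Γ Λ) : (system M S s).Small (encR M S hs c) := by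
  have h1 := pc_pos M S c.q c.Tape.head
  have h2 := pc_le M S c.q c.Tape.head
  have h3 := tapeValue_pos hs c.Tape.left
  have h4 := tapeValue_pos hs c.Tape.right
  have h5 := tapeValue_le_one hs c.Tape.left
  have h6 := tapeValue_le_one hs c.Tape.right
  constructor
  · intro i
    have : 0 < enc M S hs c i := by
      fin_cases i
      · simpa [enc] using h1
      · simpa [enc] using h3
      · simpa [enc] using h4
    simpa [encR] using this
  · have h7 : ∑ i, enc M S hs c i < ((Fintype.card (S × Γ) + 4 : ℕ) : ℚ) := by
      have h2' : (pc M S c.q c.Tape.head : ℚ) ≤ (Fintype.card (S × Γ) + 1 : ℕ) := by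
        exact_mod_cast h2
      push_cast at h2' ⊢
      simp [enc, Fin.sum_univ_three]
      simp at h2'
      linarith
    have h8 : ((∑ i, enc M S hs c i : ℚ) : ℝ) < ((Fintype.card (S × Γ) + 4 : ℕ) : ℝ) := by
      exact_mod_cast h7
    simpa [encR, system, AffineSystem.ofDiagonal] using h8

theorem holds_digitIneqs_iff {m : ℕ} {i : Fin m} {x : Fin m → ℝ} {L : ListBlank Γ}
    (hx : x i = (tapeValue hs L : ℝ)) (b : Γ) :
    (∀ c ∈ digitIneqs i (tapeBase Γ) (digit s b), Ineq.Holds c x) ↔ L.head = b := by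
  rw [holds_digitIneqs, ← digit_le_iff hs L b, hx]
  norm_cast

theorem enabled_iff (t : Trans Γ S) (c : TM0.Cfg Γ Λ) :
    (system M S s).Enabled t (encR M S hs c) ↔
      ∃ p, M t.1 t.2.1 = some p ∧ c.q = t.1 ∧ c.Tape.head = t.2.1 ∧
        match p.2 with
        | .move .left => c.Tape.left.head = t.2.2
        | .move .right => c.Tape.right.head = t.2.2
        | .write _ => True := by
  have key : ∀ h : (M t.1 t.2.1).isSome,
      ((∀ c' ∈ [Ineq.le (0 : Fin 3) (pc M S t.1 t.2.1), Ineq.ge 0 (pc M S t.1 t.2.1)],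
        Ineq.Holds c' (encR M S hs c)) ↔ c.q = t.1 ∧ c.Tape.head = t.2.1) := by
    intro h
    have h0 : encR M S hs c 0 = (pc M S c.q c.Tape.head : ℝ) := by simp [encR, enc]
    simp only [List.forall_mem_cons, Ineq.holds_le, Ineq.holds_ge, h0]
    constructor
    · rintro ⟨h1, h2, -⟩
      refine pc_inj t.1.2 h (le_antisymm ?_ ?_)
      · exact_mod_cast h1
      · exact_mod_cast h2
    · rintro ⟨h1, h2⟩
      rw [h1, h2]
      simp
  change (∀ c' ∈ guard M S s t, _) ↔ _
  unfold guard
  rcases hM : M t.1 t.2.1 with _ | ⟨q, st⟩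
  · simp [Ineq.Holds]
  · simp only [Option.some.injEq, exists_eq_left']
    rw [List.forall_mem_append, key (by simp [hM]), and_assoc]
    rcases st with (_ | _) | a
    · simp only
      rw [holds_digitIneqs_iff hs (L := c.Tape.left) (by simp [encR, enc])]
    · simp only
      rw [holds_digitIneqs_iff hs (L := c.Tape.right) (by simp [encR, enc])]
    · simp

/-- The guard confirms the guessed neighbouring symbol whenever it matters, so choosing a transition
cannot deviate from the machine. -/
theorem apply_encR (t : Trans Γ S) (c : TM0.Cfg Γ Λ)
    (h : (system M S s).Enabled t (encR M S hs c)) :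
    ∃ c' ∈ TM0.step M c, (system M S s).apply t (encR M S hs c) = encR M S hs c' := by
  obtain ⟨⟨q, st⟩, hM, hq, ha, hb⟩ := (enabled_iff M S hs t c).1 h
  obtain ⟨q₀, a, L, R⟩ := c
  simp only at hq ha hb
  subst hq ha
  have hB := (tapeBase_pos (Γ := Γ)).ne'
  have happ : ∀ c', (∀ i, scale M S t i * enc M S hs ⟨t.1, ⟨t.2.1, L, R⟩⟩ i + shift M S s t i =
      enc M S hs c' i) →
      (system M S s).apply t (encR M S hs ⟨t.1, ⟨t.2.1, L, R⟩⟩) = encR M S hs c' := by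
    intro c' h
    funext i
    rw [system, AffineSystem.apply_ofDiagonal]
    simp only [encR]
    exact_mod_cast h i
  refine ⟨⟨q, match st with
    | .move d => Tape.move d ⟨t.2.1, L, R⟩
    | .write a => Tape.write a ⟨t.2.1, L, R⟩⟩, ?_, happ _ ?_⟩
  · simp only [TM0.step, hM]
    cases st <;> rfl
  · rcases st with (_ | _) | a
    · have h1 := tapeValue_eq hs L
      rw [hb] at h1
      intro i
      fin_cases i
      · simp [scale, shift, hM, enc, Tape.move, hb]
      · simp [scale, shift, hM, enc, Tape.move, h1]
        field_simp
        ring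
      · simp [scale, shift, hM, enc, Tape.move, tapeValue_cons]
        field_simp
        ring
    · have h1 := tapeValue_eq hs R
      rw [hb] at h1
      intro i
      fin_cases i
      · simp [scale, shift, hM, enc, Tape.move, hb]
      · simp [scale, shift, hM, enc, Tape.move, tapeValue_cons]
        field_simp
        ring
      · simp [scale, shift, hM, enc, Tape.move, h1]
        field_simp
        ring
    · intro i
      fin_cases i <;> simp [scale, shift, hM, enc, Tape.write]

theorem exists_enabled {c : TM0.Cfg Γ Λ} (hc : c.q ∈ S) (h : TM0.step M c ≠ none) :
    ∃ t, (system M S s).Enabled t (encR M S hs c) := by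
  obtain ⟨q, a, L, R⟩ := c
  rcases hM : M q a with _ | ⟨q', st⟩
  · simp [TM0.step, hM] at h
  · refine ⟨(⟨q, hc⟩, a, match st with
      | .move .left => L.head
      | .move .right => R.head
      -- A write ignores the neighbouring symbol; any value serves.
      | .write _ => a), (enabled_iff M S hs _ _).2 ⟨(q', st), hM, rfl, rfl, ?_⟩⟩
    rcases st with (_ | _) | b <;> simp

/-- The condition that a halting configuration is reached. -/
noncomputable def halted (Γ : Type) [Fintype Γ] {Λ : Type} (S : Finset Λ) : List (Ineq (Fin 3)) :=
  [Ineq.ge 0 (Fintype.card (S × Γ) + 1)]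

theorem holds_halted_iff {c : TM0.Cfg Γ Λ} (hc : c.q ∈ S) :
    (∀ i ∈ halted Γ S, Ineq.Holds i (encR M S hs c)) ↔ TM0.step M c = none := by
  obtain ⟨q, a, L, R⟩ := c
  have h1 : encR M S hs ⟨q, ⟨a, L, R⟩⟩ 0 = (pc M S q a : ℝ) := by simp [encR, enc]
  have h2 : TM0.step M ⟨q, ⟨a, L, R⟩⟩ = none ↔ M q a = none := by simp [TM0.step]
  rw [h2, ← card_lt_pc_iff hc, halted]
  simp only [List.forall_mem_singleton, Ineq.holds_ge, h1]
  norm_cast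

/-! ### Halting in terms of bounded runs -/

section Halting

variable {Γ Λ : Type} [Inhabited Λ] {M : TM0.Machine Γ Λ} {S : Finset Λ} [Inhabited Γ]

/-- The configuration after some number of steps, if the machine has not halted before. -/
def run (M : TM0.Machine Γ Λ) (c : TM0.Cfg Γ Λ) : ℕ → Option (TM0.Cfg Γ Λ)
  | 0 => some c
  | n + 1 => (run M c n).bind (TM0.step M)

theorem reaches_of_run {c c' : TM0.Cfg Γ Λ} {n : ℕ} (h : run M c n = some c') :
    StateTransition.Reaches (TM0.step M) c c' := by
  induction n generalizing c' with
  | zero =>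
    obtain rfl : c = c' := by simpa [run] using h
    exact Relation.ReflTransGen.refl
  | succ n ih =>
    obtain ⟨b, hb, hbc⟩ := Option.bind_eq_some_iff.1 h
    exact (ih hb).tail hbc

theorem exists_run_of_reaches {c c' : TM0.Cfg Γ Λ}
    (h : StateTransition.Reaches (TM0.step M) c c') : ∃ n, run M c n = some c' := by
  induction h with
  | refl => exact ⟨0, rfl⟩
  | tail _ h ih =>
    obtain ⟨n, hn⟩ := ih
    exact ⟨n + 1, by rw [run, hn]; exact h⟩

theorem dom_eval_iff {c : TM0.Cfg Γ Λ} : (StateTransition.eval (TM0.step M) c).Dom ↔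
    ∃ n c', run M c n = some c' ∧ TM0.step M c' = none := by
  rw [Part.dom_iff_mem]
  constructor
  · rintro ⟨c', h⟩
    obtain ⟨h1, h2⟩ := StateTransition.mem_eval.1 h
    obtain ⟨n, hn⟩ := exists_run_of_reaches h1
    exact ⟨n, c', hn, h2⟩
  · rintro ⟨n, c', h1, h2⟩
    exact ⟨c', StateTransition.mem_eval.2 ⟨reaches_of_run h1, h2⟩⟩

theorem run_eq_none {c : TM0.Cfg Γ Λ} {n k : ℕ} (h : run M c n = none) (hk : n ≤ k) :
    run M c k = none := by
  induction hk with
  | refl => exact h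
  | step _ ih => rw [run, ih]; rfl

theorem not_dom_eval_iff {c : TM0.Cfg Γ Λ} : ¬ (StateTransition.eval (TM0.step M) c).Dom ↔
    ∀ n, run M c n ≠ none := by
  rw [dom_eval_iff]
  constructor
  · intro h n
    induction n with
    | zero => simp [run]
    | succ n ih =>
      obtain ⟨b, hb⟩ := Option.ne_none_iff_exists'.1 ih
      intro h1
      rw [run, hb] at h1
      exact h ⟨n, b, hb, h1⟩
  · rintro h ⟨n, c', h1, h2⟩
    apply h (n + 1)
    rw [run, h1]
    exact h2

theorem run_supports (hS : TM0.Supports M ↑S) {c c' : TM0.Cfg Γ Λ} (hc : c.q ∈ S) {n : ℕ}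
    (h : run M c n = some c') : c'.q ∈ S := by
  induction n generalizing c' with
  | zero =>
    obtain rfl : c = c' := by simpa [run] using h
    exact hc
  | succ n ih =>
    obtain ⟨b, hb, hbc⟩ := Option.bind_eq_some_iff.1 h
    exact_mod_cast TM0.step_supports M hS hbc (by exact_mod_cast ih hb)

end Halting

variable {Γ Λ : Type} [Fintype Γ] [Inhabited Λ] {M : TM0.Machine Γ Λ} {S : Finset Λ}
  [Inhabited Γ] [DecidableEq Γ] {s : Γ} (hs : s ≠ default) {c : TM0.Cfg Γ Λ}

theorem exists_run_of_reach {n : ℕ} {y : Fin 3 → ℝ}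
    (h : (system M S s).Reach (encR M S hs c) n y) :
    ∃ c', run M c n = some c' ∧ y = encR M S hs c' := by
  induction h with
  | zero => exact ⟨c, rfl, rfl⟩
  | succ t _ ht ih =>
    obtain ⟨b, hb, rfl⟩ := ih
    obtain ⟨c', hc', h'⟩ := apply_encR M S hs t b ht
    exact ⟨c', by rw [run, hb]; exact hc', h'⟩

theorem exists_trans (hS : TM0.Supports M ↑S) (hc : c.q ∈ S) {n : ℕ} {b b' : TM0.Cfg Γ Λ}
    (hb : run M c n = some b) (hb' : run M c (n + 1) = some b') :
    ∃ t, (system M S s).Enabled t (encR M S hs b) ∧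
      encR M S hs b' = (system M S s).apply t (encR M S hs b) := by
  have h1 : TM0.step M b = some b' := by rw [run, hb] at hb'; exact hb'
  obtain ⟨t, ht⟩ := exists_enabled M S hs (run_supports hS hc hb) (by simp [h1])
  obtain ⟨c', hc', h'⟩ := apply_encR M S hs t b ht
  obtain rfl : b' = c' := by rw [h1] at hc'; simpa using hc'
  exact ⟨t, ht, h'.symm⟩

/-- The point for the initial configuration on the input `a sⁿ`. -/
theorem enc_init (a : Γ) (n : ℕ) :
    enc M S hs (TM0.init (a :: List.replicate n s)) =
      (![(pc M S default a : ℚ), 1, ((tapeBase Γ ^ n : ℕ) : ℚ)⁻¹] : Fin 3 → ℚ) := by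
  have h1 : (Tape.mk₁ (a :: List.replicate n s)) =
      ⟨a, ListBlank.mk [], ListBlank.mk (List.replicate n s)⟩ := by
    simp [Tape.mk₁, Tape.mk₂, Tape.mk']
  rw [enc, TM0.init, h1]
  simp only [tapeValue_mk, listValue_replicate]
  rfl

variable [DecidableEq (Trans Γ S)]

theorem answer_inputU_iff [Nonempty (Trans Γ S)] (hS : TM0.Supports M ↑S) (hc : c.q ∈ S) :
    ((system M S s).inputU (halted Γ S) (enc M S hs c)).Answer ↔
      (StateTransition.eval (TM0.step M) c).Dom := by
  rw [dom_eval_iff]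
  constructor
  · intro h
    obtain ⟨n, y, hr, hH⟩ := AffineSystem.exists_reach_of_answer_inputU _ h
    obtain ⟨c', hc', rfl⟩ := exists_run_of_reach hs hr
    exact ⟨n, c', hc', (holds_halted_iff M S hs (run_supports hS hc hc')).1 hH⟩
  · rintro ⟨N, c', h1, h2⟩
    have hne : ∀ n ≤ N, ∃ b, run M c n = some b := fun n hn =>
      Option.ne_none_iff_exists'.1 fun h => by simp [run_eq_none h hn] at h1
    -- Beyond `N` the configurations are arbitrary; their points are still small, which is all the
    -- schedule needs there.
    choose! b hb using hne
    have hu : ∀ n, ∃ t, n < N → (system M S s).Enabled t (encR M S hs (b n)) ∧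
        encR M S hs (b (n + 1)) = (system M S s).apply t (encR M S hs (b n)) := by
      intro n
      by_cases hn : n < N
      · obtain ⟨t, ht⟩ := exists_trans (s := s) hs hS hc (hb n hn.le) (hb (n + 1) hn)
        exact ⟨t, fun _ => ht⟩
      · exact ⟨Classical.arbitrary _, fun h => absurd h hn⟩
    choose t ht using hu
    have h0 : b 0 = c := by have := hb 0 (Nat.zero_le N); simpa [run] using this.symm
    have hN : b N = c' := by have := hb N le_rfl; rw [h1] at this; simpa using this.symm
    refine AffineSystem.answer_inputU (u := fun n => encR M S hs (b n)) (by simp only [h0]; rfl) t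
      (fun n => small_encR M S hs _) (N := N) ht ?_
    simp only [hN]
    exact (holds_halted_iff M S hs (run_supports hS hc h1)).2 h2

/-- The machine is deterministic, so arbitrarily long runs of the system already exclude halting; no
infinite run has to be extracted. -/
theorem answer_inputG_iff [Nonempty (Trans Γ S)] (hS : TM0.Supports M ↑S) (hc : c.q ∈ S) :
    ((system M S s).inputG (enc M S hs c)).Answer ↔
      ¬ (StateTransition.eval (TM0.step M) c).Dom := by
  rw [not_dom_eval_iff]
  constructor
  · intro h n hn
    obtain ⟨k, hk, y, hr⟩ := AffineSystem.exists_reach_of_answer_inputG _ h n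
    obtain ⟨c', hc', -⟩ := exists_run_of_reach hs hr
    rw [run_eq_none hn hk] at hc'
    cases hc'
  · intro h
    choose b hb using fun n => Option.ne_none_iff_exists'.1 (h n)
    choose t ht using fun n => exists_trans (s := s) hs hS hc (hb n) (hb (n + 1))
    have h0 : b 0 = c := by have := hb 0; simpa [run] using this.symm
    exact AffineSystem.answer_inputG (u := fun n => encR M S hs (b n)) (by simp only [h0]; rfl) t
      (fun n => small_encR M S hs _) ht

/-! ### Computability of the reduction -/

/-- Codes of inputs that only differ in a coordinate `B⁻ⁿ` of the starting point are computable
from `n`. -/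
theorem computable_code {d : ℕ} (A : List (List (ℤ × ℕ))) (w : List (ℕ ⊕ List (List ℤ × ℤ)))
    (v : ℕ → Fin d → ℚ) {B : ℕ} (hB : 0 < B)
    (hv : ∀ i, (∀ n, v n i = ((B ^ n : ℕ) : ℚ)⁻¹) ∨ ∃ r, ∀ n, v n i = r) :
    Computable fun n => ((A, vecCode (v n), w) : Code) := by
  have hpow : Computable fun n : ℕ => B ^ n :=
    ((Primrec.nat_rec₁ (f := fun _ x => B * x) 1
      (Primrec.nat_mul.comp (Primrec.const B) Primrec.snd).to₂).of_eq fun n => by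
        induction n with
        | zero => rfl
        | succ n ih => simp only [ih]; ring).to_comp
  have hvec : Computable fun n => vecCode (v n) := by
    refine Computable.list_ofFn fun i => ?_
    rcases hv i with h | ⟨r, h⟩
    · refine ((Computable.const (1 : ℤ)).pair hpow).of_eq fun n => ?_
      have hpos : 0 < B ^ n := pow_pos hB n
      rw [h, Rat.inv_natCast_num_of_pos hpos, Rat.inv_natCast_den_of_pos hpos]
    · exact (Computable.const (r.num, r.den)).of_eq fun n => by rw [h]
  exact (Computable.const A).pair (hvec.pair (Computable.const w))

theorem computable_start_code (A : List (List (ℤ × ℕ))) (w : List (ℕ ⊕ List (List ℤ × ℤ))) (a : Γ) :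
    Computable fun n => ((A, vecCode (AffineSystem.start (T := Trans Γ S)
      (enc M S hs (TM0.init (a :: List.replicate n s)))), w) : Code) := by
  refine computable_code A w _ (B := tapeBase Γ) (by simp [tapeBase]) fun i => ?_
  simp only [AffineSystem.start, enc_init]
  rcases (AffineSystem.coord 3 (Trans Γ S)).symm i with v | i | i
  · exact .inr ⟨_, fun _ => rfl⟩
  · fin_cases i
    · exact .inr ⟨_, fun _ => rfl⟩
    · exact .inr ⟨_, fun _ => rfl⟩
    -- The right half-tape is the only coordinate that depends on `n`.
    · exact .inl fun _ => rfl
  · exact .inr ⟨_, fun _ => rfl⟩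

end TM
end MultiMode

theorem ComputablePred.comp_computable {α β : Type*} [Primcodable α] [Primcodable β]
    {p : β → Prop} (hp : ComputablePred p) {f : α → β} (hf : Computable f) :
    ComputablePred fun a => p (f a) := by
  obtain ⟨q, hq, rfl⟩ := ComputablePred.computable_iff.1 hp
  exact ComputablePred.computable_iff.2 ⟨fun a => q (f a), hq.comp hf, rfl⟩

theorem mainTheorem6 :
    ¬ MultiMode.ModelCheckingDecidable {MultiMode.Op.U} ∧
      ¬ MultiMode.ModelCheckingDecidable {MultiMode.Op.G, MultiMode.Op.or} := by
  classical
  obtain ⟨Γ, Λ, _, _, _, M, S, a, s, hs, hS, hund⟩ := exists_TM0_undecidable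
  have _ : Fintype Γ := Fintype.ofFinite Γ
  have hdef : default ∈ S := by exact_mod_cast hS.1
  have _ : Nonempty (MultiMode.TM.Trans Γ S) := ⟨(⟨default, hdef⟩, a, a)⟩
  constructor
  · rintro ⟨p, hp, h⟩
    refine hund ?_
    -- The formula does not depend on the starting point, so a dummy point 0 serves to name its
    -- code.
    have h1 := hp.comp_computable (MultiMode.TM.computable_start_code (M := M) (S := S) hs
      ((MultiMode.TM.system M S s).modes.map MultiMode.vecCode)
      ((MultiMode.TM.system M S s).inputU (MultiMode.TM.halted Γ S) 0).formula.code a)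
    refine h1.of_eq fun n => ?_
    rw [← MultiMode.TM.answer_inputU_iff hs hS
      (show (TM0.init (a :: List.replicate n s) : TM0.Cfg Γ Λ).q ∈ S from hdef)]
    exact h _ (MultiMode.AffineSystem.inputU_mem _ _ _)
  · rintro ⟨p, hp, h⟩
    refine hund ?_
    have h1 := hp.comp_computable (MultiMode.TM.computable_start_code (M := M) (S := S) hs
      ((MultiMode.TM.system M S s).modes.map MultiMode.vecCode)
      ((MultiMode.TM.system M S s).inputG 0).formula.code a)
    refine h1.not.of_eq fun n => ?_
    rw [← not_iff_not, not_not, ← MultiMode.TM.answer_inputG_iff hs hS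
      (show (TM0.init (a :: List.replicate n s) : TM0.Cfg Γ Λ).q ∈ S from hdef)]
    exact h _ (MultiMode.AffineSystem.inputG_mem _ _)
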